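/- Let $-\Delta$ be the Dirichlet Laplacian on the open unit disk $\mathbb D\subset\mathbb R^2$ (the operator on $L^2(\mathbb D)$ given by $u\mapsto-\Delta u$, in the weak sense, on those $u\in H^1_0(\mathbb D)$ for which $\Delta u\in L^2(\mathbb D)$). For $\lambda\ge 0$ let $N_{\mathrm{disk}}(\lambda)$ be the number of eigenvalues of $-\Delta$, counted with multiplicity, which are less than or equal to $\lambda^2$. Let \[D:=\Big\{(x,y)\in\mathbb R^2\ \Big|\ -1\le x\le 1,\ \max(0,-x)\le y\le \tfrac1\pi\big(\sqrt{1-x^2}-x\arccos x\big)\Big\}\] and let \[N_D(\lambda):=\#\big\{(n,k)\in\mathbb Z^2\ \big|\ (n,k-\tfrac14)\in\lambda D\big\}.\] Then $N_{\mathrm{disk}}(\lambda)\le N_D(\lambda)$ for every $\lambda\ge 0$. -/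

import Mathlib

open MeasureTheory
open scoped Pointwise ContDiff Distributions ENNReal

noncomputable section

/-! ### The Dirichlet Laplacian on the unit disk

The plane is `ℂ` with its real Euclidean structure and Lebesgue measure. -/

/-- The open unit disk. -/
def unitDisk : TopologicalSpace.Opens ℂ := ⟨Metric.ball 0 1, Metric.isOpen_ball⟩

/-- Complex-valued `L²` on the open unit disk. -/
abbrev DiskL2 : Type := Lp ℂ 2 (volume.restrict (unitDisk : Set ℂ))

/-- The partial derivative `∂φ/∂x` of a function on the plane. -/
def partialX (φ : ℂ → ℂ) (z : ℂ) : ℂ := fderiv ℝ φ z 1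

/-- The partial derivative `∂φ/∂y` of a function on the plane. -/
def partialY (φ : ℂ → ℂ) (z : ℂ) : ℂ := fderiv ℝ φ z Complex.I

theorem diskTest_differentiable (φ : 𝓓(unitDisk, ℂ)) : Differentiable ℝ (φ : ℂ → ℂ) :=
  φ.contDiff.differentiable (by simp)

theorem partialX_add (φ ψ : 𝓓(unitDisk, ℂ)) (z : ℂ) :
    partialX (φ + ψ : 𝓓(unitDisk, ℂ)) z = partialX φ z + partialX ψ z := by
  simp only [partialX, FunLike.coe_add]
  rw [fderiv_add (diskTest_differentiable φ z) (diskTest_differentiable ψ z)]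
  rfl

theorem partialY_add (φ ψ : 𝓓(unitDisk, ℂ)) (z : ℂ) :
    partialY (φ + ψ : 𝓓(unitDisk, ℂ)) z = partialY φ z + partialY ψ z := by
  simp only [partialY, FunLike.coe_add]
  rw [fderiv_add (diskTest_differentiable φ z) (diskTest_differentiable ψ z)]
  rfl

theorem partialX_smul (c : ℂ) (φ : 𝓓(unitDisk, ℂ)) (z : ℂ) :
    partialX (c • φ : 𝓓(unitDisk, ℂ)) z = c * partialX φ z := by
  simp only [partialX, FunLike.coe_smul]
  rw [fderiv_const_smul (diskTest_differentiable φ z)]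
  rfl

theorem partialY_smul (c : ℂ) (φ : 𝓓(unitDisk, ℂ)) (z : ℂ) :
    partialY (c • φ : 𝓓(unitDisk, ℂ)) z = c * partialY φ z := by
  simp only [partialY, FunLike.coe_smul]
  rw [fderiv_const_smul (diskTest_differentiable φ z)]
  rfl

/-- The triples `(φ, ∂φ/∂x, ∂φ/∂y)` in `L² × L² × L²`, for `φ` a smooth function with compact
support in the open disk. -/
def testGradGraph : Submodule ℂ (DiskL2 × DiskL2 × DiskL2) where
  carrier := {p | ∃ φ : 𝓓(unitDisk, ℂ),
    p.1 =ᵐ[volume.restrict (unitDisk : Set ℂ)] φ ∧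
    p.2.1 =ᵐ[volume.restrict (unitDisk : Set ℂ)] partialX φ ∧
    p.2.2 =ᵐ[volume.restrict (unitDisk : Set ℂ)] partialY φ}
  zero_mem' := by
    refine ⟨0, ?_, ?_, ?_⟩
    · exact Lp.coeFn_zero _ _ _
    · refine (Lp.coeFn_zero _ _ _).trans (Filter.Eventually.of_forall fun z => ?_)
      have h := partialX_smul 0 0 z
      rw [zero_smul, zero_mul] at h
      exact h.symm
    · refine (Lp.coeFn_zero _ _ _).trans (Filter.Eventually.of_forall fun z => ?_)
      have h := partialY_smul 0 0 z
      rw [zero_smul, zero_mul] at h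
      exact h.symm
  add_mem' := by
    rintro p q ⟨φ, h1, h2, h3⟩ ⟨ψ, k1, k2, k3⟩
    refine ⟨φ + ψ, ?_, ?_, ?_⟩
    · filter_upwards [Lp.coeFn_add p.1 q.1, h1, k1] with z a b c
      exact a.trans (congrArg₂ (· + ·) b c)
    · filter_upwards [Lp.coeFn_add p.2.1 q.2.1, h2, k2] with z a b c
      exact (a.trans (congrArg₂ (· + ·) b c)).trans (partialX_add φ ψ z).symm
    · filter_upwards [Lp.coeFn_add p.2.2 q.2.2, h3, k3] with z a b c
      exact (a.trans (congrArg₂ (· + ·) b c)).trans (partialY_add φ ψ z).symm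
  smul_mem' := by
    rintro c p ⟨φ, h1, h2, h3⟩
    refine ⟨c • φ, ?_, ?_, ?_⟩
    · filter_upwards [Lp.coeFn_smul c p.1, h1] with z a b
      exact a.trans (congrArg (c * ·) b)
    · filter_upwards [Lp.coeFn_smul c p.2.1, h2] with z a b
      exact (a.trans (congrArg (c * ·) b)).trans (partialX_smul c φ z).symm
    · filter_upwards [Lp.coeFn_smul c p.2.2, h3] with z a b
      exact (a.trans (congrArg (c * ·) b)).trans (partialY_smul c φ z).symm

/-- The Sobolev space `H¹₀` of the unit disk, i.e. the closure of the test functions in the norm of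
`H¹`. An element is recorded as the triple `(u, ∂u/∂x, ∂u/∂y)` of `u` and its weak partial
derivatives, so that the `H¹`-norm is (equivalent to) the norm of `L² × L² × L²`. -/
def diskH10 : Submodule ℂ (DiskL2 × DiskL2 × DiskL2) := testGradGraph.topologicalClosure

/-- The weak form of `-Δ u = f` in the unit disk, in terms of `∇u = (ux, uy)` and `f`:
`∫ ∇u · ∇φ = ∫ f φ` for all test functions `φ`. -/
def WeakPoisson (ux uy f : DiskL2) : Prop :=
  ∀ φ : 𝓓(unitDisk, ℂ),
    ∫ z in (unitDisk : Set ℂ), (ux z * partialX φ z + uy z * partialY φ z) =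
      ∫ z in (unitDisk : Set ℂ), f z * φ z

theorem diskTest_integrable_mul (f : DiskL2) (φ : ℂ → ℂ) (hc : Continuous φ)
    (hs : HasCompactSupport φ) :
    Integrable (fun z => f z * φ z) (volume.restrict (unitDisk : Set ℂ)) :=
  (Lp.memLp f).integrable_mul ((hc.memLp_of_hasCompactSupport hs (p := 2)))

theorem diskTest_integrable_val (f : DiskL2) (φ : 𝓓(unitDisk, ℂ)) :
    Integrable (fun z => f z * φ z) (volume.restrict (unitDisk : Set ℂ)) :=
  diskTest_integrable_mul f φ φ.contDiff.continuous φ.hasCompactSupport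

theorem diskTest_integrable_grad (ux uy : DiskL2) (φ : 𝓓(unitDisk, ℂ)) :
    Integrable (fun z => ux z * partialX φ z + uy z * partialY φ z)
      (volume.restrict (unitDisk : Set ℂ)) := by
  have hc : Continuous (fderiv ℝ (φ : ℂ → ℂ)) := φ.contDiff.continuous_fderiv (by simp)
  have hs : HasCompactSupport (fderiv ℝ (φ : ℂ → ℂ)) := φ.hasCompactSupport.fderiv ℝ
  exact (diskTest_integrable_mul ux _ (hc.clm_apply continuous_const)
      (hs.comp_left (g := fun L : ℂ →L[ℝ] ℂ => L 1) (by simp))).add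
    (diskTest_integrable_mul uy _ (hc.clm_apply continuous_const)
      (hs.comp_left (g := fun L : ℂ →L[ℝ] ℂ => L Complex.I) (by simp)))

theorem WeakPoisson.add {ux uy f vx vy g : DiskL2} (h : WeakPoisson ux uy f)
    (k : WeakPoisson vx vy g) : WeakPoisson (ux + vx) (uy + vy) (f + g) := by
  intro φ
  calc _ = ∫ z in (unitDisk : Set ℂ), ((ux z * partialX φ z + uy z * partialY φ z) +
        (vx z * partialX φ z + vy z * partialY φ z)) := by
        refine integral_congr_ae ?_
        filter_upwards [Lp.coeFn_add ux vx, Lp.coeFn_add uy vy] with z a b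
        simp only [a, b, Pi.add_apply]; ring
    _ = ∫ z in (unitDisk : Set ℂ), (f z * φ z + g z * φ z) := by
        rw [integral_add (diskTest_integrable_grad ux uy φ) (diskTest_integrable_grad vx vy φ),
          integral_add (diskTest_integrable_val f φ) (diskTest_integrable_val g φ), h φ, k φ]
    _ = _ := by
        refine integral_congr_ae ?_
        filter_upwards [Lp.coeFn_add f g] with z a
        simp only [a, Pi.add_apply]; ring

theorem WeakPoisson.smul {ux uy f : DiskL2} (c : ℂ) (h : WeakPoisson ux uy f) :
    WeakPoisson (c • ux) (c • uy) (c • f) := by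
  intro φ
  calc _ = ∫ z in (unitDisk : Set ℂ), c * (ux z * partialX φ z + uy z * partialY φ z) := by
        refine integral_congr_ae ?_
        filter_upwards [Lp.coeFn_smul c ux, Lp.coeFn_smul c uy] with z a b
        simp only [a, b, Pi.smul_apply, smul_eq_mul]; ring
    _ = ∫ z in (unitDisk : Set ℂ), c * (f z * φ z) := by
        rw [integral_const_mul, integral_const_mul, h φ]
    _ = _ := by
        refine integral_congr_ae ?_
        filter_upwards [Lp.coeFn_smul c f] with z a
        simp only [a, Pi.smul_apply, smul_eq_mul]; ring

theorem WeakPoisson.zero : WeakPoisson 0 0 0 := by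
  intro φ
  have h0 := Lp.coeFn_zero ℂ 2 (volume.restrict (unitDisk : Set ℂ))
  refine integral_congr_ae ?_
  filter_upwards [h0] with z a
  have a' : (0 : DiskL2) z = 0 := a
  simp only [a', zero_mul, add_zero]

/-- The graph in `L² × L²` of the (positive) Dirichlet Laplacian of the unit disk: the pairs
`(u, f)` with `u ∈ H¹₀` and `-Δ u = f` weakly. -/
def dirichletLaplacianGraph : Submodule ℂ (DiskL2 × DiskL2) where
  carrier := {p | ∃ ux uy : DiskL2, (p.1, ux, uy) ∈ diskH10 ∧ WeakPoisson ux uy p.2}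
  zero_mem' := ⟨0, 0, diskH10.zero_mem, WeakPoisson.zero⟩
  add_mem' := by
    rintro p q ⟨ux, uy, h, h'⟩ ⟨vx, vy, k, k'⟩
    exact ⟨ux + vx, uy + vy, diskH10.add_mem h k, h'.add k'⟩
  smul_mem' := by
    rintro c p ⟨ux, uy, h, h'⟩
    exact ⟨c • ux, c • uy, diskH10.smul_mem c h, h'.smul c⟩

/-- The eigenspace `{u | -Δ u = μ u}` of the Dirichlet Laplacian. -/
def dirichletEigenspace (μ : ℝ) : Submodule ℂ DiskL2 where
  carrier := {u | (u, (μ : ℂ) • u) ∈ dirichletLaplacianGraph}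
  zero_mem' := by
    simp only [Set.mem_ofPred_eq, smul_zero]
    exact dirichletLaplacianGraph.zero_mem
  add_mem' := by
    intro u v hu hv
    simp only [Set.mem_ofPred_eq, smul_add]
    exact dirichletLaplacianGraph.add_mem hu hv
  smul_mem' := by
    intro c u hu
    simp only [Set.mem_ofPred_eq, smul_comm (μ : ℂ) c u]
    exact dirichletLaplacianGraph.smul_mem c hu

/-- The multiplicity of `μ` as a Dirichlet eigenvalue of the unit disk (`0` if `μ` is not an
eigenvalue). -/
def dirichletMultiplicity (μ : ℝ) : ℕ∞ := (Module.rank ℂ (dirichletEigenspace μ)).toENat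

/-- The Dirichlet eigenvalue counting function of the unit disk: the number of eigenvalues
`μ ≤ r ^ 2`, counted with multiplicity (a possibly infinite sum of multiplicities, taken as the
supremum of its finite partial sums). -/
def diskCounting (r : ℝ) : ℕ∞ :=
  ⨆ s : Finset {μ : ℝ // μ ≤ r ^ 2}, ∑ μ ∈ s, dirichletMultiplicity μ

/-! ### The lattice point problem -/

/-- The Kuznecov–Fedosov domain. -/
def kuznecovFedosovDomain : Set (ℝ × ℝ) :=
  {p | -1 ≤ p.1 ∧ p.1 ≤ 1 ∧ max 0 (-p.1) ≤ p.2 ∧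
    p.2 ≤ (1 / Real.pi) * (√(1 - p.1 ^ 2) - p.1 * Real.arccos p.1)}

/-- The number of `(n, k) ∈ ℤ²` such that `(n, k - 1/4)` lies in the dilate of the domain by
`r`. -/
def latticeCounting (r : ℝ) : ℕ∞ :=
  Set.encard {p : ℤ × ℤ | ((p.1 : ℝ), (p.2 : ℝ) - 1 / 4) ∈ r • kuznecovFedosovDomain}

end

/-! The disk's eigenvalues are squares of Bessel zeros, but only an upper bound on their number is
needed, so neither an eigenbasis nor completeness of the modes is used. Fix `lam > r`. For each `(n,
t)` in `besselZeroSet lam`, require the `n`-th angular mode of a test function to vanish on the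
circle of radius `t / lam`. Under these finitely many conditions the Dirichlet form is at least `lam
^ 2` times the squared `L²` norm (`dirichlet_form_ge`): mode by mode one compares with `J_|n| (lam
r)` by a Picone-type identity, and the mode vanishes wherever that identity would divide by zero
(`radial_bessel_inequality`). The conditions are continuous in the gradient, so the inequality
passes to `H¹₀` (`exists_functionals_dirichlet_form_ge`). A nonzero sum of eigenfunctions with
eigenvalues at most `r ^ 2 < lam ^ 2` violates it, so such sums inject into the functions on
`besselZeroSet lam`, and the eigenvalue count is at most the number of these zeros.

The zeros are then counted. By `card_besselJ_zeros_le`, the `k`-th positive zero of `J_m` has Debye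
phase at least `π (k - 1/4)`. The boundary of the domain is this phase, rescaled, so sending the
`k`-th zero of `J_|n|` to `(n, k + max 0 (-n))` injects the zeros below `lam` into the lattice
points counted at `lam`. Compactness of the domain lets `lam` decrease to `r`.

The phase bound combines two facts. Sturm comparison shows that consecutive zeros are at most `π`
apart in the phase (`exists_besselJ_zero_debyePhase_le`), so the defect `π (k - 1/4) - phase` does
not decrease along the zeros. Hence it is nonpositive everywhere once it is asymptotically
nonpositive, and this is `BesselZeroBound`, proved by induction on the order. In the induction step,
zeros interlace and the shift from a zero of `J_m` to the next one of `J_{m+1}` is asymptotically at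
least `π / 2`. For order zero, a Hankel contour integral whose imaginary part is proportional to
`J₀` shows that `J₀` has no zero in `[kπ, kπ + 3π/4]`. -/

noncomputable section DiskCounting

open Filter Topology Set
open scoped Nat Interval

/-! ### Bessel functions of integer order -/

/-- The entire function `∑ (-y) ^ k / (k! (m + k)!)`. -/
def besselSeries (m : ℕ) (y : ℝ) : ℝ := ∑' k : ℕ, (-y) ^ k / (k ! * (m + k)! : ℝ)

theorem norm_besselSeries_term_le (m k : ℕ) (y : ℝ) :
    ‖(-y) ^ k / (k ! * (m + k)! : ℝ)‖ ≤ |y| ^ k / k ! := by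
  have h1 : (0 : ℝ) < k ! := by positivity
  have h2 : (1 : ℝ) ≤ (m + k)! := by exact_mod_cast Nat.one_le_iff_ne_zero.2 (Nat.factorial_ne_zero _)
  rw [norm_div, norm_pow, norm_neg, Real.norm_eq_abs, Real.norm_of_nonneg (by positivity)]
  gcongr
  nlinarith

theorem summable_besselSeries (m : ℕ) (y : ℝ) :
    Summable fun k : ℕ => (-y) ^ k / (k ! * (m + k)! : ℝ) :=
  .of_norm_bounded (Real.summable_pow_div_factorial |y|) fun k => norm_besselSeries_term_le m k y

theorem besselSeries_zero (m : ℕ) : besselSeries m 0 = 1 / (m ! : ℝ) := by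
  rw [besselSeries, tsum_eq_single 0]
  · simp
  · intro k hk
    simp [hk]

theorem hasDerivAt_besselSeries (m : ℕ) (y : ℝ) :
    HasDerivAt (besselSeries m) (-besselSeries (m + 1) y) y := by
  set R := |y| + 1 with hR
  -- Truncated subtraction makes the `k = 0` entry of this majorant equal to `1`, which is harmless
  -- because the differentiated term vanishes there.
  have hu : Summable fun k : ℕ => R ^ (k - 1) / (k - 1)! :=
    (summable_nat_add_iff 1).1 (by simpa using Real.summable_pow_div_factorial R)
  have key := hasDerivAt_tsum_of_isPreconnected (𝕜 := ℝ) (F := ℝ) (t := Metric.ball 0 R)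
    (g := fun k z => (-z) ^ k / (k ! * (m + k)! : ℝ))
    (g' := fun k z => -(k * (-z) ^ (k - 1) / (k ! * (m + k)! : ℝ))) (y₀ := y) (y := y)
    hu Metric.isOpen_ball (convex_ball _ _).isPreconnected ?_ ?_ (by simp [hR])
    (summable_besselSeries m y) (by simp [hR])
  · refine key.congr_deriv ?_
    symm
    rw [tsum_neg, Summable.tsum_eq_zero_add]
    · simp only [besselSeries, Nat.cast_zero, zero_mul, zero_div, zero_add]
      congr 1
      refine tsum_congr fun k => ?_
      rw [Nat.add_sub_cancel, Nat.factorial_succ, show m + 1 + k = m + (k + 1) by ring]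
      push_cast
      field_simp
    · refine (summable_nat_add_iff 1).1 ((summable_besselSeries (m + 1) y).congr fun k => ?_)
      rw [Nat.add_sub_cancel, Nat.factorial_succ, show m + 1 + k = m + (k + 1) by ring]
      push_cast
      field_simp
  · intro k z _
    have := (((hasDerivAt_id z).neg).pow k).div_const (k ! * (m + k)! : ℝ)
    refine this.congr_deriv ?_
    simp [neg_div]
  · intro k z hz
    rcases k with _ | k
    · simp
    · have hz' : |z| ≤ R := by simpa using (Metric.mem_ball.1 hz).le
      have h1 : -(((k + 1 : ℕ) : ℝ) * (-z) ^ (k + 1 - 1) / ((k + 1)! * (m + (k + 1))! : ℝ)) =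
          -((-z) ^ k / (k ! * (m + 1 + k)! : ℝ)) := by
        rw [Nat.add_sub_cancel, Nat.factorial_succ, show m + 1 + k = m + (k + 1) by ring]
        push_cast
        field_simp
      rw [h1, norm_neg, Nat.add_sub_cancel]
      refine (norm_besselSeries_term_le (m + 1) k z).trans ?_
      gcongr

/-- Compare coefficients through `1 / (m + k)! = (m + 1 + k) / (m + 1 + k)!`. Together with the
derivative rule this contains Bessel's equation, so no later differential identity returns to the
series. -/
theorem besselSeries_recurrence (m : ℕ) (y : ℝ) :
    besselSeries m y = (m + 1) * besselSeries (m + 1) y - y * besselSeries (m + 2) y := by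
  have h2 : y * besselSeries (m + 2) y =
      ∑' k : ℕ, -(k * ((-y) ^ k / (k ! * (m + 1 + k)! : ℝ))) := by
    rw [Summable.tsum_eq_zero_add]
    · rw [besselSeries, ← tsum_mul_left]
      simp only [Nat.cast_zero, zero_mul, neg_zero, zero_add]
      refine tsum_congr fun k => ?_
      rw [Nat.factorial_succ, show m + 1 + (k + 1) = m + 2 + k by ring, pow_succ]
      push_cast
      field_simp
    · refine (summable_nat_add_iff 1).1
        (((summable_besselSeries (m + 2) y).mul_left y).congr fun k => ?_)
      rw [Nat.factorial_succ, show m + 1 + (k + 1) = m + 2 + k by ring, pow_succ]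
      push_cast
      field_simp
  have hs : Summable fun k : ℕ => -(k * ((-y) ^ k / (k ! * (m + 1 + k)! : ℝ))) := by
    refine (summable_nat_add_iff 1).1
        (((summable_besselSeries (m + 2) y).mul_left y).congr fun k => ?_)
    rw [Nat.factorial_succ, show m + 1 + (k + 1) = m + 2 + k by ring, pow_succ]
    push_cast
    field_simp
  rw [h2, besselSeries, besselSeries, ← tsum_mul_left,
    ← ((summable_besselSeries (m + 1) y).mul_left _).tsum_sub hs]
  refine tsum_congr fun k => ?_
  rw [show m + 1 + k = (m + k) + 1 by ring, Nat.factorial_succ (m + k)]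
  push_cast
  field_simp
  ring

/-- By dominated convergence only the term `k = 0` survives. The limit serves to exclude that the
series of all large orders vanish at the same point. -/
theorem tendsto_factorial_mul_besselSeries (y : ℝ) :
    Tendsto (fun m : ℕ => m ! * besselSeries m y) atTop (𝓝 1) := by
  have h : ∀ m : ℕ, m ! * besselSeries m y =
      ∑' k : ℕ, (m ! / (m + k)! : ℝ) * ((-y) ^ k / k !) := by
    intro m
    rw [besselSeries, ← tsum_mul_left]
    refine tsum_congr fun k => ?_
    field_simp
  simp only [h]
  have hlim : (∑' k : ℕ, if k = 0 then (1 : ℝ) else 0) = 1 := by simp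
  rw [← hlim]
  refine tendsto_tsum_of_dominated_convergence (Real.summable_pow_div_factorial |y|) ?_ ?_
  · intro k
    rcases k with _ | k
    · simp only [Nat.add_zero, if_true, pow_zero, Nat.factorial_zero, Nat.cast_one, div_one, mul_one]
      refine tendsto_const_nhds.congr fun m => ?_
      rw [div_self (by positivity)]
    · simp only [Nat.add_eq_zero_iff, one_ne_zero, and_false, if_false]
      rw [← zero_mul ((-y) ^ (k + 1) / (k + 1)! : ℝ)]
      refine Tendsto.mul_const _ ?_
      refine squeeze_zero (fun m => by positivity) (fun m => ?_)
        (tendsto_one_div_add_atTop_nhds_zero_nat (𝕜 := ℝ))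
      rw [div_le_div_iff₀ (by positivity) (by positivity), one_mul]
      have : m ! * (m + 1) ≤ (m + (k + 1))! := by
        rw [mul_comm, ← Nat.factorial_succ]
        exact Nat.factorial_le (by omega)
      exact_mod_cast this
  · refine Eventually.of_forall fun m k => ?_
    rw [norm_mul, norm_div ((-y) ^ k), norm_pow, norm_neg, Real.norm_eq_abs y,
      Real.norm_of_nonneg (by positivity : (0 : ℝ) ≤ k !),
      Real.norm_of_nonneg (by positivity : (0 : ℝ) ≤ (m ! / (m + k)! : ℝ))]
    have : (m ! / (m + k)! : ℝ) ≤ 1 := by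
      rw [div_le_one (by positivity)]
      exact_mod_cast Nat.factorial_le (by omega)
    exact mul_le_of_le_one_left (by positivity) this

/-- Two consecutive vanishing orders propagate upwards by the recurrence, against the limit `1` of
`m ! * besselSeries m y`. This replaces ODE uniqueness and makes the positive zeros of `J_m` simple.
-/
theorem besselSeries_ne_zero_or (m : ℕ) {y : ℝ} (hy : 0 < y) :
    besselSeries m y ≠ 0 ∨ besselSeries (m + 1) y ≠ 0 := by
  by_contra! h
  have all : ∀ j : ℕ, besselSeries (m + j) y = 0 ∧ besselSeries (m + j + 1) y = 0 := by
    intro j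
    induction j with
    | zero => exact h
    | succ j ih =>
      refine ⟨ih.2, ?_⟩
      have := besselSeries_recurrence (m + j) y
      rw [ih.1, ih.2] at this
      have h0 : y * besselSeries (m + j + 2) y = 0 := by linarith
      exact (mul_eq_zero.1 h0).resolve_left hy.ne'
  have h1 := (tendsto_factorial_mul_besselSeries y).comp (tendsto_add_atTop_nat m)
  have h2 : (fun n : ℕ => (n ! : ℝ) * besselSeries n y) ∘ (fun a => a + m) = fun _ => 0 := by
    ext j
    simp [add_comm j m, (all j).1]
  rw [h2] at h1
  exact zero_ne_one (tendsto_nhds_unique tendsto_const_nhds h1)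

/-- `2 ^ m` times the Bessel function of the first kind of order `m`. -/
def besselJ (m : ℕ) (x : ℝ) : ℝ := x ^ m * besselSeries m (x ^ 2 / 4)

/-- The Euler derivative `x ↦ x * deriv (besselJ m) x`. -/
def besselE (m : ℕ) (x : ℝ) : ℝ :=
  m * besselJ m x - x ^ (m + 2) / 2 * besselSeries (m + 1) (x ^ 2 / 4)

theorem hasDerivAt_besselSeries_sq (m : ℕ) (x : ℝ) :
    HasDerivAt (fun x => besselSeries m (x ^ 2 / 4))
      (-(x / 2 * besselSeries (m + 1) (x ^ 2 / 4))) x := by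
  have h : HasDerivAt (fun x : ℝ => x ^ 2 / 4) (x / 2) x := by
    refine ((hasDerivAt_pow 2 x).div_const 4).congr_deriv ?_
    simp; ring
  refine ((hasDerivAt_besselSeries m (x ^ 2 / 4)).comp x h).congr_deriv ?_
  ring

theorem continuous_besselSeries (m : ℕ) : Continuous (besselSeries m) :=
  continuous_iff_continuousAt.2 fun y => (hasDerivAt_besselSeries m y).continuousAt

theorem continuous_besselJ (m : ℕ) : Continuous (besselJ m) := by
  unfold besselJ
  have := continuous_besselSeries m
  fun_prop

theorem continuous_besselE (m : ℕ) : Continuous (besselE m) := by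
  unfold besselE
  have := continuous_besselSeries (m + 1)
  have := continuous_besselJ m
  fun_prop

theorem hasDerivAt_besselJ (m : ℕ) {x : ℝ} (hx : x ≠ 0) :
    HasDerivAt (besselJ m) (besselE m x / x) x := by
  refine ((hasDerivAt_pow m x).mul (hasDerivAt_besselSeries_sq m x)).congr_deriv ?_
  unfold besselE besselJ
  rcases m with _ | m
  · simp; field_simp
  · simp only [Nat.add_sub_cancel]
    field_simp
    push_cast; ring

/-- With `hasDerivAt_besselJ` this is Bessel's equation as a first-order system for `J` and `E = x
J'`. -/
theorem hasDerivAt_besselE (m : ℕ) {x : ℝ} (hx : x ≠ 0) :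
    HasDerivAt (besselE m) ((m ^ 2 / x - x) * besselJ m x) x := by
  have h1 := (((hasDerivAt_pow (m + 2) x).div_const 2).mul
    (hasDerivAt_besselSeries_sq (m + 1) x))
  refine (((hasDerivAt_besselJ m hx).const_mul (m : ℝ)).sub h1).congr_deriv ?_
  unfold besselE besselJ
  have := besselSeries_recurrence m (x ^ 2 / 4)
  rw [this]
  simp only [show m + 2 - 1 = m + 1 by omega]
  push_cast
  field_simp
  ring

theorem besselJ_ne_zero_or (m : ℕ) {x : ℝ} (hx : 0 < x) (h : besselJ m x = 0) :
    besselE m x ≠ 0 := by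
  have h0 : besselSeries m (x ^ 2 / 4) = 0 :=
    (mul_eq_zero.1 h).resolve_left (pow_pos hx m).ne'
  have h1 := (besselSeries_ne_zero_or m (y := x ^ 2 / 4) (by positivity)).resolve_left (by simpa)
  rw [besselE, h, mul_zero, zero_sub, neg_ne_zero]
  positivity

theorem besselJ_zero_iff (m : ℕ) {x : ℝ} (hx : 0 < x) :
    besselJ m x = 0 ↔ besselSeries m (x ^ 2 / 4) = 0 := by
  unfold besselJ
  simp [hx.ne']

/-- Below the turning point `m` both terms of `(J E)' = E² / t + (m² / t - t) J²` are nonnegative,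
so `J E ≥ 0` and `J²` is nondecreasing. A zero at `x ≤ m` would make `J` vanish on all of `(0, x]`,
against the value `1 / m !` of the series at `0`. -/
theorem lt_of_besselJ_eq_zero (m : ℕ) {x : ℝ} (hx : 0 < x) (h : besselJ m x = 0) : (m : ℝ) < x := by
  by_contra! hxm
  have hJE : MonotoneOn (fun t => besselJ m t * besselE m t) (Icc 0 x) := by
    refine monotoneOn_of_hasDerivWithinAt_nonneg (convex_Icc 0 x)
      (f' := fun t => besselE m t / t * besselE m t + besselJ m t * ((m ^ 2 / t - t) * besselJ m t))
      ((continuous_besselJ m).mul (continuous_besselE m)).continuousOn (fun t ht => ?_) fun t ht => ?_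
    · rw [interior_Icc] at ht
      exact ((hasDerivAt_besselJ m ht.1.ne').mul (hasDerivAt_besselE m ht.1.ne')).hasDerivWithinAt
    · rw [interior_Icc] at ht
      have h0 := ht.1
      have h1 : (0 : ℝ) ≤ m ^ 2 / t - t := by
        rw [sub_nonneg, le_div_iff₀ h0]
        nlinarith [ht.2]
      have h2 : besselE m t / t * besselE m t + besselJ m t * ((m ^ 2 / t - t) * besselJ m t) =
        besselE m t ^ 2 / t + (m ^ 2 / t - t) * besselJ m t ^ 2 := by ring
      rw [h2]
      positivity
  have h00 : besselJ m 0 * besselE m 0 = 0 := by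
    rcases m with _ | m
    · simp [besselE, besselJ]
    · simp [besselJ]
  have hJ2 : MonotoneOn (fun t => besselJ m t * besselJ m t) (Icc 0 x) := by
    refine monotoneOn_of_hasDerivWithinAt_nonneg (convex_Icc 0 x)
      (f' := fun t => besselE m t / t * besselJ m t + besselJ m t * (besselE m t / t))
      ((continuous_besselJ m).mul (continuous_besselJ m)).continuousOn (fun t ht => ?_) fun t ht => ?_
    · rw [interior_Icc] at ht
      exact ((hasDerivAt_besselJ m ht.1.ne').mul (hasDerivAt_besselJ m ht.1.ne')).hasDerivWithinAt
    · rw [interior_Icc] at ht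
      have h1 := hJE (left_mem_Icc.2 hx.le) (Ioo_subset_Icc_self ht) ht.1.le
      simp only [h00] at h1
      have h2 : besselE m t / t * besselJ m t + besselJ m t * (besselE m t / t) =
        2 * (besselJ m t * besselE m t) / t := by ring
      rw [h2]
      exact div_nonneg (by linarith) ht.1.le
  have hzero : ∀ t ∈ Ioc 0 x, besselSeries m (t ^ 2 / 4) = 0 := by
    intro t ht
    rw [← besselJ_zero_iff m ht.1]
    have h1 := hJ2 (Ioc_subset_Icc_self ht) (right_mem_Icc.2 hx.le) ht.2
    simp only [h, mul_zero] at h1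
    exact mul_self_eq_zero.1 (le_antisymm h1 (mul_self_nonneg _))
  have hc : Tendsto (fun t : ℝ => besselSeries m (t ^ 2 / 4)) (𝓝[>] 0) (𝓝 (besselSeries m 0)) := by
    have : ContinuousAt (fun t : ℝ => besselSeries m (t ^ 2 / 4)) 0 :=
      (hasDerivAt_besselSeries_sq m 0).continuousAt
    simpa using this.tendsto.mono_left nhdsWithin_le_nhds
  have hc' : Tendsto (fun t : ℝ => besselSeries m (t ^ 2 / 4)) (𝓝[>] 0) (𝓝 0) := by
    refine tendsto_const_nhds.congr' ?_
    filter_upwards [Ioc_mem_nhdsGT hx] with t ht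
    exact (hzero t ht).symm
  have := tendsto_nhds_unique hc hc'
  rw [besselSeries_zero] at this
  have : (0 : ℝ) < 1 / m ! := by positivity
  linarith

/-! ### Zeros of consecutive orders: quarter periods, interlacing, asymptotic count -/

/-- For the damped oscillator `f'' + (c / x) f' + f = 0`, the distance between a zero of `f` and a
later critical point. -/
theorem pi_div_two_le_of_damped {f g : ℝ → ℝ} {c z y : ℝ} (hc : 0 ≤ c) (hz : 0 < z) (hzy : z < y)
    (hf : ∀ x ∈ Icc z y, HasDerivAt f (g x) x)
    (hg : ∀ x ∈ Icc z y, HasDerivAt g (-(c / x) * g x - f x) x)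
    (hne : ∀ x ∈ Icc z y, f x = 0 → g x ≠ 0) (hfz : f z = 0) (hgy : g y = 0) :
    Real.pi / 2 ≤ (1 + c / (2 * z)) * (y - z) := by
  have hfc : ContinuousOn f (Icc z y) := fun x hx => (hf x hx).continuousAt.continuousWithinAt
  have hcomp : IsCompact (Icc z y ∩ f ⁻¹' {0}) :=
    isCompact_Icc.of_isClosed_subset (hfc.preimage_isClosed_of_isClosed isClosed_Icc isClosed_singleton)
      inter_subset_left
  -- Beyond the last zero `w` of `f` the Prüfer angle `arctan (g / f)` is smooth; it starts from `π
  -- / 2` at `w` and reaches `0` at `y`.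
  obtain ⟨w, ⟨hw, hfw⟩, hmax⟩ := hcomp.exists_isGreatest ⟨z, left_mem_Icc.2 hzy.le, hfz⟩
  have hfw : f w = 0 := hfw
  have hwy : w < y := lt_of_le_of_ne hw.2 fun h => hne w hw hfw (h ▸ hgy)
  have hne' : ∀ x ∈ Ioc w y, f x ≠ 0 := fun x hx h0 =>
    absurd (hmax ⟨⟨hw.1.trans hx.1.le, hx.2⟩, h0⟩) (not_le.2 hx.1)
  -- The angle falls at speed at most `κ`: the oscillation contributes `1`, and the damping at most
  -- `(c / t) |f g| / (f² + g²) ≤ c / (2 z)`.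
  set κ := 1 + c / (2 * z) with hκ
  have hb : ∀ x ∈ Ioo w y, Real.arctan (g x / f x) ≤ κ * (y - x) := by
    intro x hx
    have hsub : ∀ t ∈ Icc x y, t ∈ Ioc w y ∧ t ∈ Icc z y := fun t ht =>
      ⟨⟨hx.1.trans_le ht.1, ht.2⟩, ⟨hw.1.trans (hx.1.le.trans ht.1), ht.2⟩⟩
    have hd : ∀ t ∈ Icc x y, HasDerivAt (fun t => Real.arctan (g t / f t) + κ * t)
        (1 / (1 + (g t / f t) ^ 2) * (((-(c / t) * g t - f t) * f t - g t * g t) / f t ^ 2) + κ * 1) t :=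
      fun t ht => (((hg t (hsub t ht).2).div (hf t (hsub t ht).2)
        (hne' t (hsub t ht).1)).arctan).add ((hasDerivAt_id t).const_mul κ)
    have hmono : MonotoneOn (fun t => Real.arctan (g t / f t) + κ * t) (Icc x y) := by
      refine monotoneOn_of_hasDerivWithinAt_nonneg (convex_Icc x y)
        (fun t ht => (hd t ht).continuousAt.continuousWithinAt)
        (fun t ht => (hd t (interior_subset ht)).hasDerivWithinAt) fun t ht => ?_
      have ht' := hsub t (interior_subset ht)
      have hft := hne' t ht'.1
      have htz : z ≤ t := ht'.2.1
      have ht0 : 0 < t := hz.trans_le htz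
      have hS : 0 < f t ^ 2 + g t ^ 2 := by positivity
      have e : 1 / (1 + (g t / f t) ^ 2) * (((-(c / t) * g t - f t) * f t - g t * g t) / f t ^ 2) =
          (-(c / t) * (g t * f t)) / (f t ^ 2 + g t ^ 2) - 1 := by
        field_simp
        ring
      have h3 : c / t ≤ c / z := div_le_div_of_nonneg_left hc hz htz
      have h4 : -(c / (2 * z)) ≤ (-(c / t) * (g t * f t)) / (f t ^ 2 + g t ^ 2) := by
        rw [le_div_iff₀ hS]
        have h5 : c / (2 * z) = (c / z) / 2 := by field_simp
        have h6 : 0 ≤ c / t := by positivity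
        rw [h5]
        nlinarith [sq_nonneg (f t + g t), sq_nonneg (f t - g t)]
      rw [e, mul_one, hκ]
      linarith
    have h1 := hmono (left_mem_Icc.2 hx.2.le) (right_mem_Icc.2 hx.2.le) hx.2.le
    simp only [hgy, zero_div, Real.arctan_zero] at h1
    linarith
  have hgw := hne w hw hfw
  have hslope : Tendsto (fun x => (x - w)⁻¹ * f x) (𝓝[>] w) (𝓝 (g w)) := by
    have := (hasDerivAt_iff_tendsto_slope.1 (hf w hw)).mono_left
      (nhdsWithin_mono w fun x (hx : w < x) => hx.ne')
    refine this.congr fun x => ?_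
    simp [slope, hfw]
  have hinv : Tendsto (fun x => (x - w)⁻¹) (𝓝[>] w) atTop := by
    refine tendsto_inv_nhdsGT_zero.comp (tendsto_nhdsWithin_iff.2 ⟨?_, ?_⟩)
    · have : Tendsto (fun x => x - w) (𝓝 w) (𝓝 (w - w)) := tendsto_id.sub_const w
      rw [sub_self] at this
      exact this.mono_left nhdsWithin_le_nhds
    · filter_upwards [self_mem_nhdsWithin] with x hx using mem_Ioi.2 (sub_pos.2 (mem_Ioi.1 hx))
  have hlim : Tendsto (fun x => g x / f x) (𝓝[>] w) atTop := by
    have h1 : Tendsto (fun x => g x / ((x - w)⁻¹ * f x)) (𝓝[>] w) (𝓝 (g w / g w)) :=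
      ((hg w hw).continuousAt.tendsto.mono_left nhdsWithin_le_nhds).div hslope hgw
    rw [div_self hgw] at h1
    refine (hinv.atTop_mul_pos one_pos h1).congr' ?_
    filter_upwards [self_mem_nhdsWithin] with x hx
    have : x - w ≠ 0 := (sub_pos.2 (mem_Ioi.1 hx)).ne'
    field_simp
  have hlim2 : Tendsto (fun x => Real.arctan (g x / f x)) (𝓝[>] w) (𝓝 (Real.pi / 2)) :=
    (Real.tendsto_arctan_atTop.mono_right nhdsWithin_le_nhds).comp hlim
  have hlim3 : Tendsto (fun x => κ * (y - x)) (𝓝[>] w) (𝓝 (κ * (y - w))) :=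
    (Continuous.tendsto (by fun_prop) w).mono_left nhdsWithin_le_nhds
  have h1 : Real.pi / 2 ≤ κ * (y - w) := by
    refine le_of_tendsto_of_tendsto hlim2 hlim3 ?_
    filter_upwards [Ioo_mem_nhdsGT hwy] with x hx using hb x hx
  have hκ0 : 0 ≤ κ := by positivity
  exact h1.trans (mul_le_mul_of_nonneg_left (by linarith [hw.1]) hκ0)

/-- The function `x⁻ᵐ J_m` solves the damped equation with `c = 2 m + 1`, and its positive critical
points are the zeros of `J_{m+1}`. -/
theorem besselJ_quarter_period (m : ℕ) {z y : ℝ} (hz : 0 < z) (hzy : z < y)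
    (h1 : besselJ m z = 0) (h2 : besselJ (m + 1) y = 0) :
    Real.pi / 2 ≤ (1 + (2 * m + 1) / (2 * z)) * (y - z) := by
  rw [besselJ_zero_iff m hz] at h1
  rw [besselJ_zero_iff _ (hz.trans hzy)] at h2
  refine pi_div_two_le_of_damped (f := fun x => besselSeries m (x ^ 2 / 4))
    (g := fun x => -(x / 2 * besselSeries (m + 1) (x ^ 2 / 4))) (by positivity) hz hzy
    (fun x _ => hasDerivAt_besselSeries_sq m x) (fun x hx => ?_) (fun x hx h => ?_) h1 (by simp [h2])
  · have hx0 : x ≠ 0 := (hz.trans_le hx.1).ne'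
    refine ((((hasDerivAt_id x).div_const 2).mul
      (hasDerivAt_besselSeries_sq (m + 1) x)).neg).congr_deriv ?_
    rw [besselSeries_recurrence m (x ^ 2 / 4)]
    simp only [id]
    field_simp
    ring
  · have hx0 : 0 < x := hz.trans_le hx.1
    have := (besselSeries_ne_zero_or m (y := x ^ 2 / 4) (by positivity)).resolve_left (by simpa using h)
    simp [hx0.ne', this]

/-- Rolle's theorem for `x^(m+1) J_{m+1}`, whose derivative is a multiple of `x^(m+1) J_m`. The
power makes it vanish at `0` too, so a zero of `J_m` is also found below the first zero of
`J_{m+1}`. -/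
theorem exists_besselJ_zero_between (m : ℕ) {p y : ℝ} (hp : 0 ≤ p) (hpy : p < y)
    (h1 : p = 0 ∨ besselJ (m + 1) p = 0) (h2 : besselJ (m + 1) y = 0) :
    ∃ z ∈ Ioo p y, besselJ m z = 0 := by
  have hd : ∀ x : ℝ, HasDerivAt (fun x => x ^ (2 * m + 2) * besselSeries (m + 1) (x ^ 2 / 4))
      (2 * x ^ (2 * m + 1) * besselSeries m (x ^ 2 / 4)) x := by
    intro x
    refine ((hasDerivAt_pow (2 * m + 2) x).mul (hasDerivAt_besselSeries_sq (m + 1) x)).congr_deriv ?_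
    rw [besselSeries_recurrence m (x ^ 2 / 4), show 2 * m + 2 - 1 = 2 * m + 1 by omega]
    push_cast
    ring
  have hzero : ∀ x : ℝ, 0 ≤ x → x = 0 ∨ besselJ (m + 1) x = 0 →
      x ^ (2 * m + 2) * besselSeries (m + 1) (x ^ 2 / 4) = 0 := by
    rintro x hx (h | h)
    · simp [h]
    · rcases hx.eq_or_lt with h0 | h0
      · simp [← h0]
      · rw [(besselJ_zero_iff _ h0).1 h, mul_zero]
  obtain ⟨z, hz, hz0⟩ := exists_hasDerivAt_eq_zero hpy
    (fun x _ => (hd x).continuousAt.continuousWithinAt)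
    ((hzero p hp h1).trans (hzero y (hp.trans hpy.le) (Or.inr h2)).symm) fun x _ => hd x
  have hz1 : 0 < z := hp.trans_lt hz.1
  refine ⟨z, hz, (besselJ_zero_iff m hz1).2 ?_⟩
  exact (mul_eq_zero.1 hz0).resolve_left (by positivity)

/-- Zeros of Bessel functions of consecutive orders interlace. -/
theorem exists_finset_besselJ_zeros (m : ℕ) (S : Finset ℝ)
    (hS : ∀ s ∈ S, 0 < s ∧ besselJ (m + 1) s = 0) {y : ℝ} (hy : y ∈ S) (hmax : ∀ s ∈ S, s ≤ y) :
    ∃ z, 0 < z ∧ z < y ∧ besselJ m z = 0 ∧ ∃ T : Finset ℝ, T.card = S.card ∧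
      ∀ t ∈ T, 0 < t ∧ t ≤ z ∧ besselJ m t = 0 := by
  have key : ∀ s ∈ S, ∃ z, 0 < z ∧ z < s ∧ besselJ m z = 0 ∧ ∀ s' ∈ S, s' < s → s' < z := by
    intro s hs
    by_cases hne : (S.filter (· < s)).Nonempty
    · have hm := Finset.max'_mem _ hne
      set p := (S.filter (· < s)).max' hne
      rw [Finset.mem_filter] at hm
      obtain ⟨z, hz, hz0⟩ := exists_besselJ_zero_between m (hS p hm.1).1.le hm.2
        (Or.inr (hS p hm.1).2) (hS s hs).2
      refine ⟨z, (hS p hm.1).1.trans hz.1, hz.2, hz0, fun s' hs' hlt => lt_of_le_of_lt ?_ hz.1⟩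
      exact Finset.le_max' _ _ (Finset.mem_filter.2 ⟨hs', hlt⟩)
    · obtain ⟨z, hz, hz0⟩ := exists_besselJ_zero_between m le_rfl (hS s hs).1 (Or.inl rfl) (hS s hs).2
      exact ⟨z, hz.1, hz.2, hz0, fun s' hs' hlt =>
        absurd ⟨s', Finset.mem_filter.2 ⟨hs', hlt⟩⟩ hne⟩
  choose! Z h0 h1 h2 h3 using key
  have hlt : ∀ s ∈ S, ∀ s' ∈ S, s' < s → Z s' < Z s := fun s hs s' hs' h =>
    (h1 s' hs').trans (h3 s hs s' hs' h)
  refine ⟨Z y, h0 y hy, h1 y hy, h2 y hy, S.image Z, ?_, ?_⟩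
  · refine Finset.card_image_of_injOn fun a ha b hb hab => ?_
    by_contra hne
    rcases lt_or_gt_of_ne hne with h | h
    · exact (hlt b hb a ha h).ne hab
    · exact (hlt a ha b hb h).ne' hab
  · intro t ht
    obtain ⟨s, hs, rfl⟩ := Finset.mem_image.1 ht
    refine ⟨h0 s hs, ?_, h2 s hs⟩
    rcases (hmax s hs).eq_or_lt with h | h
    · rw [h]
    · exact (hlt y hy s hs h).le

/-- An asymptotic upper bound for the number of zeros of `J_m`. -/
def BesselZeroBound (m : ℕ) : Prop :=
  ∀ ε > 0, ∃ X : ℝ, ∀ x ≥ X, ∀ S : Finset ℝ, (∀ s ∈ S, 0 < s ∧ s ≤ x ∧ besselJ m s = 0) →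
    (S.card : ℝ) ≤ x / Real.pi - m / 2 + 1 / 4 + ε

/-- Interlacing provides as many zeros of `J_m` up to some `z` below the largest zero `y` of
`J_{m+1}`. The quarter-period estimate puts `z` nearly `π / 2` before `y`, which lowers the count by
`1 / 2`, the change of `m / 2` from one order to the next. -/
theorem BesselZeroBound.succ {m : ℕ} (h : BesselZeroBound m) : BesselZeroBound (m + 1) := by
  intro ε hε
  have hpi := Real.pi_pos
  obtain ⟨X₀, hX₀⟩ := h (ε / 2) (by positivity)
  -- Beyond `X₁` the damping correction `(2 m + 1) / (2 z)` is at most `ε`. If `z < X₁`, the zeros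
  -- are counted at `X₁` instead, which is at least `π / 2` below `x`.
  set X₁ := max (max X₀ 1) ((2 * m + 1) / (2 * ε)) with hX₁
  refine ⟨max (X₁ + Real.pi / 2) (Real.pi * ((m + 1) / 2)), fun x hx S hS => ?_⟩
  have hx1 := (le_max_left _ _).trans hx
  have hx2 := (le_max_right _ _).trans hx
  rcases S.eq_empty_or_nonempty with rfl | hne
  · have : ((m + 1 : ℝ) / 2) ≤ x / Real.pi := by
      rw [le_div_iff₀ hpi]; linarith
    push_cast
    simp only [Finset.card_empty, Nat.cast_zero]
    linarith
  have hy := S.max'_mem hne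
  obtain ⟨z, hz, hzy, hz0, T, hT, hT'⟩ := exists_finset_besselJ_zeros m S
    (fun s hs => ⟨(hS s hs).1, (hS s hs).2.2⟩) hy (fun s hs => S.le_max' s hs)
  set y := S.max' hne
  have hyx : y ≤ x := (hS y hy).2.1
  have e1 : ∀ a : ℝ, (a - Real.pi / 2) / Real.pi = a / Real.pi - 1 / 2 := fun a => by field_simp
  push_cast
  rw [← hT]
  by_cases hzX : X₁ ≤ z
  · have hzX' : max X₀ 1 ≤ z := (le_max_left _ _).trans hzX
    have b1 := hX₀ z ((le_max_left _ _).trans hzX') T hT'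
    have b2 := besselJ_quarter_period m hz hzy hz0 (hS y hy).2.2
    have b3 : (2 * m + 1) / (2 * z) ≤ ε := by
      have := (le_max_right _ _).trans hzX
      rw [div_le_iff₀ (by positivity)] at this ⊢
      linarith
    have b4 : (1 - ε) * (Real.pi / 2) ≤ y - z := by
      have hyz : 0 < y - z := sub_pos.2 hzy
      by_cases hε1 : ε ≤ 1
      · have : (1 - ε) * (Real.pi / 2) ≤ (1 - ε) * ((1 + ε) * (y - z)) := by
          refine mul_le_mul_of_nonneg_left (b2.trans ?_) (by linarith)
          gcongr
        nlinarith [mul_nonneg (sq_nonneg ε) hyz.le]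
      · nlinarith
    have b5 : z / Real.pi ≤ x / Real.pi - 1 / 2 + ε / 2 := by
      rw [div_le_iff₀ hpi, add_mul, sub_mul, div_mul_cancel₀ _ hpi.ne']
      nlinarith
    linarith
  · push Not at hzX
    have b1 := hX₀ X₁ ((le_max_left _ _).trans (le_max_left _ _)) T
      fun t ht => ⟨(hT' t ht).1, (hT' t ht).2.1.trans hzX.le, (hT' t ht).2.2⟩
    have b2 : X₁ / Real.pi ≤ x / Real.pi - 1 / 2 := by
      rw [← e1]
      gcongr
      linarith
    linarith

/-! ### The Debye phase and Sturm comparison -/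

/-- The phase `√(x² - m²) - m arccos (m / x)` of the Debye expansion of `J_m`. -/
def debyePhase (m x : ℝ) : ℝ := √(x ^ 2 - m ^ 2) - m * Real.arccos (m / x)

theorem hasDerivAt_debyePhase {m x : ℝ} (hm : 0 ≤ m) (hx : m < x) :
    HasDerivAt (debyePhase m) (√(x ^ 2 - m ^ 2) / x) x := by
  have hx0 : 0 < x := hm.trans_lt hx
  have hQ : 0 < x ^ 2 - m ^ 2 := by nlinarith
  have hmx : m / x < 1 := (div_lt_one hx0).2 hx
  have hmx0 : 0 ≤ m / x := by positivity
  have h1 : HasDerivAt (fun x : ℝ => √(x ^ 2 - m ^ 2)) (x / √(x ^ 2 - m ^ 2)) x := by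
    refine (((hasDerivAt_pow 2 x).sub_const (m ^ 2)).sqrt hQ.ne').congr_deriv ?_
    simp only [Nat.cast_ofNat, Nat.add_one_sub_one, pow_one]
    field_simp
  have h2 : HasDerivAt (fun x : ℝ => m / x) (-m / x ^ 2) x := by
    refine ((hasDerivAt_const x m).div (hasDerivAt_id x) hx0.ne').congr_deriv ?_
    simp
  have h3 := (Real.hasDerivAt_arccos (x := m / x) (by linarith) hmx.ne).comp x h2
  refine (h1.sub (h3.const_mul m)).congr_deriv ?_
  have h4 : √(1 - (m / x) ^ 2) = √(x ^ 2 - m ^ 2) / x := by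
    rw [show 1 - (m / x) ^ 2 = (x ^ 2 - m ^ 2) / x ^ 2 by field_simp, Real.sqrt_div hQ.le,
      Real.sqrt_sq hx0.le]
  rw [h4]
  have hs : 0 < √(x ^ 2 - m ^ 2) := Real.sqrt_pos.2 hQ
  have hs2 : √(x ^ 2 - m ^ 2) ^ 2 = x ^ 2 - m ^ 2 := Real.sq_sqrt hQ.le
  field_simp
  rw [hs2]

theorem continuousOn_debyePhase (m : ℝ) : ContinuousOn (debyePhase m) (Ioi 0) := by
  unfold debyePhase
  refine ContinuousOn.sub (by fun_prop) (continuousOn_const.mul ?_)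
  refine Real.continuous_arccos.comp_continuousOn ?_
  exact continuousOn_const.div continuousOn_id fun x hx => ne_of_gt hx

theorem debyePhase_le {m x y : ℝ} (hm : 0 ≤ m) (hx : m < x) (hxy : x ≤ y) :
    debyePhase m x ≤ debyePhase m y := by
  have : MonotoneOn (debyePhase m) (Icc x y) := by
    refine monotoneOn_of_hasDerivWithinAt_nonneg (convex_Icc x y)
      (fun t ht => (hasDerivAt_debyePhase hm (hx.trans_le ht.1)).continuousAt.continuousWithinAt)
      (fun t ht => (hasDerivAt_debyePhase hm
        (hx.trans_le (interior_subset ht).1)).hasDerivWithinAt) fun t ht => ?_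
    have : 0 ≤ t := hm.trans (hx.le.trans (interior_subset ht).1)
    positivity
  exact this (left_mem_Icc.2 hxy) (right_mem_Icc.2 hxy) hxy

theorem le_debyePhase {m x : ℝ} (hm : 0 ≤ m) (hx : m < x) :
    x - m * (Real.pi / 2) - m ^ 2 / x ≤ debyePhase m x := by
  have hx0 : 0 < x := hm.trans_lt hx
  have h1 : x - m ^ 2 / x ≤ √(x ^ 2 - m ^ 2) := by
    refine Real.le_sqrt_of_sq_le ?_
    have : (x - m ^ 2 / x) ^ 2 = x ^ 2 - m ^ 2 - (m ^ 2 / x ^ 2) * (x ^ 2 - m ^ 2) := by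
      field_simp
    rw [this]
    have : 0 ≤ x ^ 2 - m ^ 2 := by nlinarith
    have : 0 ≤ (m ^ 2 / x ^ 2) * (x ^ 2 - m ^ 2) := by positivity
    linarith
  have h2 : m * Real.arccos (m / x) ≤ m * (Real.pi / 2) :=
    mul_le_mul_of_nonneg_left (Real.arccos_le_pi_div_two.2 (by positivity)) hm
  unfold debyePhase
  linarith

theorem exists_debyePhase_eq {m a c : ℝ} (hm : 0 ≤ m) (ha : m < a) (hc : 0 < c) :
    ∃ b, a < b ∧ debyePhase m b = debyePhase m a + c := by
  set B := max a (debyePhase m a + c + m * (Real.pi / 2) + m) with hB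
  have hB1 : a ≤ B := le_max_left _ _
  have hB2 := le_max_right a (debyePhase m a + c + m * (Real.pi / 2) + m)
  have h1 := le_debyePhase hm (ha.trans_le hB1)
  have hB0 : 0 < B := hm.trans_lt (ha.trans_le hB1)
  have h2 : m ^ 2 / B ≤ m := by
    rw [div_le_iff₀ hB0]; nlinarith
  have h3 : debyePhase m a + c ∈ Icc (debyePhase m a) (debyePhase m B) := by
    constructor <;> linarith
  obtain ⟨b, hb, hb'⟩ := intermediate_value_Icc hB1
    ((continuousOn_debyePhase m).mono fun x hx => mem_Ioi.2 ((hm.trans_lt ha).trans_le hx.1)) h3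
  refine ⟨b, lt_of_le_of_ne hb.1 ?_, hb'⟩
  rintro rfl
  linarith

/-- Sturm comparison: consecutive zeros of `J_m` are at most `π` apart in the Debye phase. -/
theorem exists_besselJ_zero_debyePhase_le (m : ℕ) {a : ℝ} (ha0 : 0 < a) (ha : besselJ m a = 0) :
    ∃ b, a < b ∧ besselJ m b = 0 ∧ debyePhase m b ≤ debyePhase m a + Real.pi := by
  have hma := lt_of_besselJ_eq_zero m ha0 ha
  have hm : (0 : ℝ) ≤ m := m.cast_nonneg
  obtain ⟨b, hab, hb⟩ := exists_debyePhase_eq hm hma Real.pi_pos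
  by_contra! hcon
  have hne : ∀ x ∈ Ioc a b, besselJ m x ≠ 0 := by
    intro x hx h0
    have := hcon x hx.1 h0
    have := debyePhase_le hm (hma.trans hx.1) hx.2
    linarith
  have hpos : ∀ x ∈ Ioc a b, 0 < besselJ m x * besselJ m b := by
    intro x hx
    by_contra! hle
    have hmem : (0 : ℝ) ∈ Icc (besselJ m x * besselJ m b) (besselJ m b * besselJ m b) :=
      ⟨hle, mul_self_nonneg _⟩
    obtain ⟨t, ht, ht0⟩ := intermediate_value_Icc hx.2
      (((continuous_besselJ m).mul_const (besselJ m b)).continuousOn) hmem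
    rcases mul_eq_zero.1 ht0 with h | h
    · exact hne t ⟨hx.1.trans_le ht.1, ht.2⟩ h
    · exact hne b ⟨hab, le_rfl⟩ h
  set q : ℝ → ℝ := fun x => √√(x ^ 2 - m ^ 2) with hq
  set θ : ℝ → ℝ := fun x => debyePhase m x - debyePhase m a with hθ
  have hqpos : ∀ x ∈ Icc a b, 0 < q x ∧ q x ^ 2 = √(x ^ 2 - m ^ 2) ∧ q x ^ 4 = x ^ 2 - m ^ 2 := by
    intro x hx
    have hQ : 0 < x ^ 2 - m ^ 2 := by nlinarith [hx.1]
    have h1 : 0 < √(x ^ 2 - m ^ 2) := Real.sqrt_pos.2 hQ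
    have h2 : q x ^ 2 = √(x ^ 2 - m ^ 2) := Real.sq_sqrt h1.le
    refine ⟨Real.sqrt_pos.2 h1, h2, ?_⟩
    rw [show q x ^ 4 = (q x ^ 2) ^ 2 by ring, h2, Real.sq_sqrt hQ.le]
  have hqd : ∀ x ∈ Icc a b, HasDerivAt q (x / (2 * q x ^ 3)) x := by
    intro x hx
    obtain ⟨h1, h2, h3⟩ := hqpos x hx
    have hQ : x ^ 2 - (m : ℝ) ^ 2 ≠ 0 := by rw [← h3]; positivity
    have hS : √(x ^ 2 - (m : ℝ) ^ 2) ≠ 0 := by rw [← h2]; positivity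
    refine ((((hasDerivAt_pow 2 x).sub_const ((m : ℝ) ^ 2)).sqrt hQ).sqrt hS).congr_deriv ?_
    rw [← h2, show √(q x ^ 2) = q x from Real.sqrt_sq h1.le]
    simp only [Nat.cast_ofNat, Nat.add_one_sub_one, pow_one]
    field_simp
  have hθd : ∀ x ∈ Icc a b, HasDerivAt θ (q x ^ 2 / x) x := by
    intro x hx
    rw [(hqpos x hx).2.1]
    exact (hasDerivAt_debyePhase hm (hma.trans_le hx.1)).sub_const _
  -- `v` is the Debye approximation with its zeros at `a` and `b`, and `V = x v'`. Since `a > m`,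
  -- the interval stays clear of the turning point, where `q` vanishes.
  set v : ℝ → ℝ := fun x => Real.sin (θ x) / q x with hv
  set V : ℝ → ℝ := fun x => q x * Real.cos (θ x) - x ^ 2 * Real.sin (θ x) / (2 * q x ^ 5) with hV
  have hvd : ∀ x ∈ Icc a b, HasDerivAt v (V x / x) x := by
    intro x hx
    have hq0 := (hqpos x hx).1
    have hx0 : 0 < x := ha0.trans_le hx.1
    refine ((hθd x hx).sin.div (hqd x hx) hq0.ne').congr_deriv ?_
    simp only [hV]
    field_simp
  -- `v` satisfies `x (x v')' = (m² - x² + δ) v`, which is Bessel's equation up to the extra term `δ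
  -- ≥ 0`. So `v` oscillates more slowly than `J_m`.
  set δ : ℝ → ℝ := fun x => x ^ 2 * (x ^ 2 / 4 + m ^ 2) / q x ^ 8 with hδ
  have hVd : ∀ x ∈ Icc a b, HasDerivAt V ((δ x - q x ^ 4) * v x / x) x := by
    intro x hx
    obtain ⟨hq0, -, hq4⟩ := hqpos x hx
    have hx0 : 0 < x := ha0.trans_le hx.1
    refine (((hqd x hx).mul (hθd x hx).cos).sub (((hasDerivAt_pow 2 x).mul (hθd x hx).sin).div
      (((hqd x hx).pow 5).const_mul 2) (mul_pos two_pos (pow_pos hq0 5)).ne')).congr_deriv ?_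
    simp only [hδ, hv, Pi.pow_apply, Pi.mul_apply]
    rw [show (m : ℝ) ^ 2 = x ^ 2 - q x ^ 4 by linarith]
    simp only [Nat.cast_ofNat, Nat.add_one_sub_one, pow_one]
    field_simp
    ring
  -- The Wronskian of `J_m` and `v`, multiplied by `J_m b` to fix the sign. It vanishes at `a` and
  -- is nonincreasing, yet equals `q b * J_m b ^ 2 > 0` at `b`.
  have hWd : ∀ x ∈ Icc a b, HasDerivAt
      (fun x => (besselE m x * v x - besselJ m x * V x) * besselJ m b)
      (-(δ x * v x / x) * (besselJ m x * besselJ m b)) x := by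
    intro x hx
    have hx0 : 0 < x := ha0.trans_le hx.1
    have hq4 := (hqpos x hx).2.2
    refine ((((hasDerivAt_besselE m hx0.ne').mul (hvd x hx)).sub
      ((hasDerivAt_besselJ m hx0.ne').mul (hVd x hx))).mul_const _).congr_deriv ?_
    rw [show (m : ℝ) ^ 2 = x ^ 2 - q x ^ 4 by linarith]
    field_simp
    ring
  have hanti : AntitoneOn (fun x => (besselE m x * v x - besselJ m x * V x) * besselJ m b)
      (Icc a b) := by
    refine antitoneOn_of_hasDerivWithinAt_nonpos (convex_Icc a b)
      (fun t ht => (hWd t ht).continuousAt.continuousWithinAt)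
      (fun t ht => (hWd t (interior_subset ht)).hasDerivWithinAt) fun t ht => ?_
    rw [interior_Icc] at ht
    have ht' := Ioo_subset_Icc_self ht
    have ht0 : 0 < t := ha0.trans ht.1
    have hq0 := (hqpos t ht').1
    have hsin : 0 ≤ Real.sin (θ t) := by
      refine Real.sin_nonneg_of_nonneg_of_le_pi ?_ ?_
      · exact sub_nonneg.2 (debyePhase_le hm hma ht.1.le)
      · have := debyePhase_le hm (hma.trans ht.1) ht.2.le
        simp only [hθ]; linarith
    have hv0 : 0 ≤ v t := by positivity
    have hδ0 : 0 ≤ δ t := by positivity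
    have := (hpos t (Ioo_subset_Ioc_self ht)).le
    have : 0 ≤ δ t * v t / t * (besselJ m t * besselJ m b) := by positivity
    linarith
  have h1 := hanti (left_mem_Icc.2 hab.le) (right_mem_Icc.2 hab.le) hab.le
  have hθa : θ a = 0 := sub_self _
  have hθb : θ b = Real.pi := by simp only [hθ, hb]; ring
  simp only [hv, hV, hθa, hθb, ha, Real.sin_zero, Real.sin_pi, Real.cos_pi] at h1
  have h2 := hpos b ⟨hab, le_rfl⟩
  have h3 := (hqpos b ⟨hab.le, le_rfl⟩).1
  have : 0 < q b * (besselJ m b * besselJ m b) := by positivity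
  ring_nf at h1 this
  linarith

theorem exists_finset_besselJ_zeros_extend (m : ℕ) (S : Finset ℝ) {a : ℝ}
    (hS : ∀ s ∈ S, 0 < s ∧ s ≤ a ∧ besselJ m s = 0) (ha : a ∈ S) (l : ℕ) :
    ∃ (S' : Finset ℝ) (a' : ℝ), (∀ s ∈ S', 0 < s ∧ s ≤ a' ∧ besselJ m s = 0) ∧ a' ∈ S' ∧
      S'.card = S.card + l ∧ debyePhase m a' ≤ debyePhase m a + Real.pi * l := by
  induction l with
  | zero => exact ⟨S, a, hS, ha, rfl, by simp⟩
  | succ l ih =>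
    obtain ⟨S', a', h1, h2, h3, h4⟩ := ih
    obtain ⟨b, hb1, hb2, hb3⟩ := exists_besselJ_zero_debyePhase_le m (h1 a' h2).1 (h1 a' h2).2.2
    have hbS : b ∉ S' := fun h => absurd (h1 b h).2.1 (not_le.2 hb1)
    refine ⟨insert b S', b, fun s hs => ?_, Finset.mem_insert_self _ _, ?_, ?_⟩
    · rcases Finset.mem_insert.1 hs with rfl | hs
      · exact ⟨(h1 a' h2).1.trans hb1, le_rfl, hb2⟩
      · exact ⟨(h1 s hs).1, (h1 s hs).2.1.trans hb1.le, (h1 s hs).2.2⟩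
    · rw [Finset.card_insert_of_notMem hbS, h3, add_assoc]
    · push_cast
      linarith

/-- Adjoin `l` further zeros, each costing at most `π` of phase. At the last one the asymptotic
count and `le_debyePhase` give the bound up to `ε`, and the `l` cancels on both sides. -/
theorem BesselZeroBound.card_le {m : ℕ} (h : BesselZeroBound m) (S : Finset ℝ) {x : ℝ}
    (hS : ∀ s ∈ S, 0 < s ∧ s ≤ x ∧ besselJ m s = 0) (hne : S.Nonempty) :
    (m : ℝ) < x ∧ Real.pi * (S.card - 1 / 4) ≤ debyePhase m x := by
  have hpi := Real.pi_pos
  have hm : (0 : ℝ) ≤ m := m.cast_nonneg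
  have ha := S.max'_mem hne
  have hmax : ∀ s ∈ S, s ≤ S.max' hne := fun s hs => S.le_max' s hs
  set a := S.max' hne
  have hma := lt_of_besselJ_eq_zero m (hS a ha).1 (hS a ha).2.2
  have hax := (hS a ha).2.1
  refine ⟨hma.trans_le hax, le_trans ?_ (debyePhase_le hm hma hax)⟩
  have key : ∀ ε > 0, (S.card : ℝ) - 1 / 4 ≤ debyePhase m a / Real.pi + ε := by
    intro ε hε
    obtain ⟨X₀, hX₀⟩ := h (ε / 2) (by positivity)
    set X := max X₀ (m ^ 2 / (Real.pi * (ε / 2)))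
    -- More zeros than the asymptotic count allows up to `X`, so the last one must lie beyond `X`.
    obtain ⟨l, hl⟩ := exists_nat_gt (X / Real.pi - m / 2 + 1 / 4 + ε / 2)
    obtain ⟨S', a', h1, h2, h3, h4⟩ := exists_finset_besselJ_zeros_extend m S
      (fun s hs => ⟨(hS s hs).1, hmax s hs, (hS s hs).2.2⟩) ha l
    have hma' := lt_of_besselJ_eq_zero m (h1 a' h2).1 (h1 a' h2).2.2
    have hcard : (S'.card : ℝ) = S.card + l := by rw [h3]; push_cast; ring
    have hXa : X ≤ a' := by
      by_contra! hlt
      have := hX₀ X (le_max_left _ _) S' fun s hs =>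
        ⟨(h1 s hs).1, (h1 s hs).2.1.trans hlt.le, (h1 s hs).2.2⟩
      have : (0 : ℝ) ≤ S.card := by positivity
      linarith
    have b1 := hX₀ a' ((le_max_left _ _).trans hXa) S' h1
    have b2 := le_debyePhase hm hma'
    have ha0 := (h1 a' h2).1
    have b3 : (m : ℝ) ^ 2 / a' ≤ Real.pi * (ε / 2) := by
      have := (le_max_right _ _).trans hXa
      rw [div_le_iff₀ (by positivity)] at this ⊢
      linarith
    have b4 : a' / Real.pi - m / 2 ≤ debyePhase m a / Real.pi + l + ε / 2 := by
      have : a' - m * (Real.pi / 2) ≤ debyePhase m a + Real.pi * l + Real.pi * (ε / 2) := by linarith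
      have h5 : (a' - m * (Real.pi / 2)) / Real.pi ≤
        (debyePhase m a + Real.pi * l + Real.pi * (ε / 2)) / Real.pi := by gcongr
      have h6 : (a' - m * (Real.pi / 2)) / Real.pi = a' / Real.pi - m / 2 := by field_simp
      have h7 : (debyePhase m a + Real.pi * l + Real.pi * (ε / 2)) / Real.pi =
        debyePhase m a / Real.pi + l + ε / 2 := by field_simp
      linarith
    linarith
  have := le_of_forall_pos_le_add key
  rw [le_div_iff₀ hpi] at this
  linarith

/-! ### The phase of `J₀` at infinity -/

/-- The polynomial `s² - 2 i s`. -/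
def hankelPoly (s : ℝ) : ℂ := (s : ℂ) ^ 2 - 2 * Complex.I * s

/-- The inverse square root of `s² - 2 i s`. -/
def hankelKernel (s : ℝ) : ℂ := Complex.exp (-(Complex.log (hankelPoly s) / 2))

/-- The integrand of the contour integral for the Hankel function of order zero. -/
def hankelIntegrand (j : ℕ) (x s : ℝ) : ℂ :=
  Complex.exp ((Complex.I - s) * x) * ((Complex.I - s) ^ j * hankelKernel s)

/-- A contour integral for the Hankel function of order zero, and its derivatives. -/
def hankelIntegral (j : ℕ) (x : ℝ) : ℂ := ∫ s in Ioi (0 : ℝ), hankelIntegrand j x s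

theorem hankelPoly_re (s : ℝ) : (hankelPoly s).re = s ^ 2 := by
  simp [hankelPoly, ← Complex.ofReal_pow]

theorem hankelPoly_im (s : ℝ) : (hankelPoly s).im = -(2 * s) := by
  simp [hankelPoly, ← Complex.ofReal_pow]

theorem hankelPoly_mem_slitPlane {s : ℝ} (hs : 0 < s) : hankelPoly s ∈ Complex.slitPlane := by
  left; rw [hankelPoly_re]; positivity

theorem hankelPoly_ne_zero {s : ℝ} (hs : 0 < s) : hankelPoly s ≠ 0 :=
  Complex.slitPlane_ne_zero (hankelPoly_mem_slitPlane hs)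

theorem two_mul_le_norm_hankelPoly {s : ℝ} (hs : 0 < s) : 2 * s ≤ ‖hankelPoly s‖ := by
  have := Complex.abs_im_le_norm (hankelPoly s)
  rwa [hankelPoly_im, abs_neg, abs_of_pos (by positivity)] at this

theorem norm_hankelPoly_le {s : ℝ} (hs : 0 < s) : ‖hankelPoly s‖ ≤ s * (s + 2) := by
  refine (norm_sub_le _ _).trans ?_
  simp [abs_of_pos hs]
  linarith

theorem arg_hankelPoly {s : ℝ} (hs : 0 < s) :
    -(Real.pi / 2) < (hankelPoly s).arg ∧ (hankelPoly s).arg < 0 := by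
  constructor
  · have := Complex.abs_arg_lt_pi_div_two_iff.2
      (Or.inl (by rw [hankelPoly_re]; positivity : 0 < (hankelPoly s).re))
    exact (abs_lt.1 this).1
  · rw [Complex.arg_neg_iff, hankelPoly_im]; linarith

theorem hankelKernel_sq {s : ℝ} (hs : 0 < s) : hankelKernel s ^ 2 = (hankelPoly s)⁻¹ := by
  rw [hankelKernel, ← Complex.exp_nat_mul, ← Complex.exp_log (hankelPoly_ne_zero hs),
    ← Complex.exp_neg, Complex.exp_log (hankelPoly_ne_zero hs)]
  congr 1
  push_cast
  ring

theorem norm_hankelKernel_le {s : ℝ} (hs : 0 < s) : ‖hankelKernel s‖ ≤ s ^ (-(1 / 2) : ℝ) := by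
  have h1 : ‖hankelKernel s‖ ^ 2 ≤ s⁻¹ := by
    rw [← norm_pow, hankelKernel_sq hs, norm_inv]
    exact inv_anti₀ hs (by linarith [two_mul_le_norm_hankelPoly hs])
  have h2 : (s ^ (-(1 / 2) : ℝ)) ^ 2 = s⁻¹ := by
    rw [← Real.rpow_natCast, ← Real.rpow_mul hs.le, ← Real.rpow_neg_one]
    norm_num
  rw [← h2] at h1
  exact le_of_sq_le_sq h1 (by positivity)

theorem hasDerivAt_hankelPoly (s : ℝ) :
    HasDerivAt hankelPoly (2 * (s - Complex.I)) s := by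
  have h := (hasDerivAt_id s).ofReal_comp
  refine ((h.pow 2).sub (h.const_mul (2 * Complex.I))).congr_deriv ?_
  simp; ring

theorem hasDerivAt_hankelKernel {s : ℝ} (hs : 0 < s) :
    HasDerivAt hankelKernel (-((s - Complex.I) / hankelPoly s * hankelKernel s)) s := by
  have h1 := (hasDerivAt_hankelPoly s).clog_real (hankelPoly_mem_slitPlane hs)
  refine ((h1.div_const 2).neg.cexp).congr_deriv ?_
  simp only [hankelKernel, Pi.neg_apply]
  ring

theorem continuousOn_hankelIntegrand (j : ℕ) (x : ℝ) :
    ContinuousOn (hankelIntegrand j x) (Ioi 0) := by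
  have : ContinuousOn hankelKernel (Ioi 0) := fun s hs =>
    (hasDerivAt_hankelKernel hs).continuousAt.continuousWithinAt
  unfold hankelIntegrand
  fun_prop

theorem norm_exp_hankel (x s : ℝ) : ‖Complex.exp ((Complex.I - s) * x)‖ = Real.exp (-x * s) := by
  rw [Complex.norm_exp]
  simp
  ring

theorem norm_I_sub_le {s : ℝ} (hs : 0 < s) : ‖Complex.I - s‖ ≤ 1 + s := by
  refine (norm_sub_le _ _).trans ?_
  simp [abs_of_pos hs]

theorem norm_hankelIntegrand_le {j : ℕ} (hj : j ≤ 2) (x : ℝ) {s : ℝ} (hs : 0 < s) :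
    ‖hankelIntegrand j x s‖ ≤ (1 + s) ^ 2 * (s ^ (-(1 / 2) : ℝ) * Real.exp (-x * s)) := by
  rw [hankelIntegrand, norm_mul, norm_mul, norm_exp_hankel, norm_pow]
  have h1 : ‖Complex.I - s‖ ^ j ≤ (1 + s) ^ 2 :=
    (pow_le_pow_left₀ (norm_nonneg _) (norm_I_sub_le hs) j).trans
      (pow_le_pow_right₀ (by linarith) hj)
  have h2 := norm_hankelKernel_le hs
  calc _ ≤ Real.exp (-x * s) * ((1 + s) ^ 2 * s ^ (-(1 / 2) : ℝ)) := by gcongr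
    _ = _ := by ring

theorem integrableOn_hankel_bound {b : ℝ} (hb : 0 < b) :
    IntegrableOn (fun s : ℝ => (1 + s) ^ 2 * (s ^ (-(1 / 2) : ℝ) * Real.exp (-b * s))) (Ioi 0) := by
  have h : ∀ a : ℝ, -1 < a → IntegrableOn (fun s : ℝ => s ^ a * Real.exp (-b * s)) (Ioi 0) := by
    intro a ha
    simpa using integrableOn_rpow_mul_exp_neg_mul_rpow ha one_pos hb
  refine (((h (-(1 / 2)) (by norm_num)).add ((h (1 / 2) (by norm_num)).const_mul 2)).add
    (h (3 / 2) (by norm_num))).congr_fun (fun s hs => ?_) measurableSet_Ioi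
  have hs : 0 < s := hs
  have e1 : s ^ (1 / 2 : ℝ) = s * s ^ (-(1 / 2) : ℝ) := by
    rw [← Real.rpow_one_add' hs.le (by norm_num)]; norm_num
  have e2 : s ^ (3 / 2 : ℝ) = s * (s * s ^ (-(1 / 2) : ℝ)) := by
    rw [← e1, ← Real.rpow_one_add' hs.le (by norm_num)]; norm_num
  simp only [Pi.add_apply, e1, e2]
  ring

theorem integrableOn_hankelIntegrand {j : ℕ} (hj : j ≤ 2) {x : ℝ} (hx : 0 < x) :
    IntegrableOn (hankelIntegrand j x) (Ioi 0) := by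
  refine Integrable.mono' (integrableOn_hankel_bound hx)
    ((continuousOn_hankelIntegrand j x).aestronglyMeasurable measurableSet_Ioi) ?_
  filter_upwards [ae_restrict_mem measurableSet_Ioi] with s hs
  exact norm_hankelIntegrand_le hj x hs

theorem hasDerivAt_hankelIntegral {j : ℕ} (hj : j ≤ 1) {x : ℝ} (hx : 0 < x) :
    HasDerivAt (hankelIntegral j) (hankelIntegral (j + 1) x) x := by
  refine (hasDerivAt_integral_of_dominated_loc_of_deriv_le (𝕜 := ℝ) (F := hankelIntegrand j)
    (F' := hankelIntegrand (j + 1)) (s := Ioi (x / 2)) (Ioi_mem_nhds (by linarith))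
    (bound := fun s : ℝ => (1 + s) ^ 2 * (s ^ (-(1 / 2) : ℝ) * Real.exp (-(x / 2) * s)))
    (Eventually.of_forall fun t =>
      (continuousOn_hankelIntegrand j t).aestronglyMeasurable measurableSet_Ioi)
    (integrableOn_hankelIntegrand (by omega) hx)
    ((continuousOn_hankelIntegrand _ x).aestronglyMeasurable measurableSet_Ioi) ?_
    (integrableOn_hankel_bound (by positivity)) ?_).2
  · filter_upwards [ae_restrict_mem measurableSet_Ioi] with s hs t ht
    have hs : 0 < s := hs
    have ht : x / 2 < t := ht
    refine (norm_hankelIntegrand_le (by omega) t hs).trans ?_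
    gcongr
  · refine Eventually.of_forall fun s t _ => ?_
    have h := (((hasDerivAt_id t).ofReal_comp).const_mul (Complex.I - s)).cexp.mul_const
      ((Complex.I - s) ^ j * hankelKernel s)
    refine h.congr_deriv ?_
    simp only [hankelIntegrand, id, Complex.ofReal_one]
    ring

theorem tendsto_rpow_neg_half_mul_self :
    Tendsto (fun s : ℝ => s ^ (-(1 / 2) : ℝ) * s) (𝓝[>] 0) (𝓝 0) := by
  have h : Tendsto (fun s : ℝ => s ^ (1 / 2 : ℝ)) (𝓝[>] 0) (𝓝 0) := by
    have := (Real.continuousAt_rpow_const 0 (1 / 2 : ℝ) (Or.inr (by norm_num))).tendsto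
    rw [Real.zero_rpow (by norm_num)] at this
    exact this.mono_left nhdsWithin_le_nhds
  refine h.congr' ?_
  filter_upwards [self_mem_nhdsWithin] with s hs
  have hs : 0 < s := hs
  rw [← Real.rpow_add_one hs.ne']
  norm_num

/-- With `ζ = i - s` the kernel is `(ζ² + 1)^(-1/2)`. The combined integrand is minus the
`s`-derivative of `e^(ζ x) (ζ² + 1)^(1/2)`, which vanishes at `s = 0` and at infinity. This is
Bessel's equation of order zero. -/
theorem hankelIntegral_ode {x : ℝ} (hx : 0 < x) :
    x * hankelIntegral 2 x + hankelIntegral 1 x + x * hankelIntegral 0 x = 0 := by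
  set f : ℝ → ℂ := fun s =>
    Complex.exp ((Complex.I - s) * x) * (hankelPoly s * hankelKernel s) with hf
  have hnorm : ∀ s : ℝ, 0 < s → ‖f s‖ ≤ (s + 2) * (s ^ (-(1 / 2) : ℝ) * s) * Real.exp (-x * s) := by
    intro s hs
    rw [hf]
    simp only
    rw [norm_mul, norm_mul, norm_exp_hankel]
    calc _ ≤ Real.exp (-x * s) * (s * (s + 2) * s ^ (-(1 / 2) : ℝ)) := by
          gcongr
          · exact norm_hankelPoly_le hs
          · exact norm_hankelKernel_le hs
      _ = _ := by ring
  have hP0 : hankelPoly 0 = 0 := by simp [hankelPoly]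
  have hf0 : f 0 = 0 := by simp [hf, hP0]
  have hcont : ContinuousWithinAt f (Ici 0) 0 := by
    rw [← continuousWithinAt_Ioi_iff_Ici, ContinuousWithinAt, hf0]
    have h1 : Tendsto (fun s : ℝ => (s + 2) * (s ^ (-(1 / 2) : ℝ) * s) * Real.exp (-x * s))
        (𝓝[>] 0) (𝓝 ((0 + 2) * 0 * Real.exp (-x * 0))) := by
      refine Tendsto.mul (Tendsto.mul ?_ tendsto_rpow_neg_half_mul_self) ?_
      · exact (Continuous.tendsto (by fun_prop) 0).mono_left nhdsWithin_le_nhds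
      · exact (Continuous.tendsto (by fun_prop) 0).mono_left nhdsWithin_le_nhds
    rw [mul_zero, zero_mul] at h1
    refine squeeze_zero_norm' ?_ h1
    filter_upwards [self_mem_nhdsWithin] with s hs using hnorm s hs
  have hinf : Tendsto f atTop (𝓝 0) := by
    have h1 : Tendsto (fun s : ℝ => s ^ (2 : ℝ) * Real.exp (-x * s)) atTop (𝓝 0) :=
      tendsto_rpow_mul_exp_neg_mul_atTop_nhds_zero 2 x hx
    have h2 := h1.const_mul 3
    rw [mul_zero] at h2
    refine squeeze_zero_norm' ?_ h2
    filter_upwards [eventually_ge_atTop 1] with s hs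
    have hs0 : 0 < s := by linarith
    refine (hnorm s hs0).trans ?_
    have h3 : s ^ (-(1 / 2) : ℝ) ≤ 1 := Real.rpow_le_one_of_one_le_of_nonpos hs (by norm_num)
    have h4 : s ^ (-(1 / 2) : ℝ) * s ≤ s := by nlinarith
    have h5 : (s + 2) * (s ^ (-(1 / 2) : ℝ) * s) ≤ 3 * s ^ (2 : ℝ) := by
      rw [Real.rpow_two]
      nlinarith
    calc _ ≤ 3 * s ^ (2 : ℝ) * Real.exp (-x * s) := by gcongr
      _ = _ := by ring
  have hderiv : ∀ s ∈ Ioi (0 : ℝ), HasDerivAt f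
      (-(x * hankelIntegrand 2 x s + hankelIntegrand 1 x s + x * hankelIntegrand 0 x s)) s := by
    intro s hs
    have hs : 0 < s := hs
    have h1 := (((hasDerivAt_id s).ofReal_comp).const_sub Complex.I).mul_const (x : ℂ)
    refine (h1.cexp.mul ((hasDerivAt_hankelPoly s).mul (hasDerivAt_hankelKernel hs))).congr_deriv ?_
    have hP := hankelPoly_ne_zero hs
    simp only [hankelIntegrand, id, Complex.ofReal_one, Pi.mul_apply]
    have e : (Complex.I - s) ^ 2 = hankelPoly s - 1 := by
      rw [hankelPoly]; ring_nf; rw [Complex.I_sq]; ring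
    rw [e]
    field_simp
    ring
  have hi0 := integrableOn_hankelIntegrand (j := 0) (by norm_num) hx
  have hi1 := integrableOn_hankelIntegrand (j := 1) (by norm_num) hx
  have hi2 := integrableOn_hankelIntegrand (j := 2) (by norm_num) hx
  have key := integral_Ioi_of_hasDerivAt_of_tendsto hcont hderiv
    (((hi2.const_mul (x : ℂ)).add hi1).add (hi0.const_mul (x : ℂ))).neg hinf
  rw [hf0, sub_zero, integral_neg, neg_eq_zero] at key
  rw [← key, integral_add (f := fun s => x * hankelIntegrand 2 x s + hankelIntegrand 1 x s)
      ((hi2.const_mul (x : ℂ)).add hi1) (hi0.const_mul (x : ℂ)),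
    integral_add (hi2.const_mul (x : ℂ)) hi1, integral_const_mul, integral_const_mul]
  rfl

theorem hankelKernel_eq {s : ℝ} :
    hankelKernel s = Complex.exp (((-(Real.log ‖hankelPoly s‖) / 2 : ℝ) : ℂ) +
      ((-(hankelPoly s).arg / 2 : ℝ) : ℂ) * Complex.I) := by
  rw [hankelKernel, Complex.log]
  congr 1
  push_cast
  ring

theorem hankelKernel_re_pos {s : ℝ} (hs : 0 < s) : 0 < (hankelKernel s).re := by
  obtain ⟨h1, h2⟩ := arg_hankelPoly hs
  rw [hankelKernel_eq, Complex.exp_re]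
  simp only [Complex.add_re, Complex.ofReal_re, Complex.mul_re, Complex.I_re, mul_zero,
    Complex.ofReal_im, Complex.I_im, mul_one, sub_self, add_zero, Complex.add_im, Complex.mul_im,
    zero_add]
  have := Real.cos_pos_of_mem_Ioo (x := -(hankelPoly s).arg / 2)
    ⟨by linarith [Real.pi_pos], by linarith [Real.pi_pos]⟩
  positivity

theorem hankelKernel_im_pos {s : ℝ} (hs : 0 < s) : 0 < (hankelKernel s).im := by
  obtain ⟨h1, h2⟩ := arg_hankelPoly hs
  rw [hankelKernel_eq, Complex.exp_im]
  simp only [Complex.add_re, Complex.ofReal_re, Complex.mul_re, Complex.I_re, mul_zero,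
    Complex.ofReal_im, Complex.I_im, mul_one, sub_self, add_zero, Complex.add_im, Complex.mul_im,
    zero_add]
  have := Real.sin_pos_of_pos_of_lt_pi (x := -(hankelPoly s).arg / 2)
    (by linarith [Real.pi_pos]) (by linarith [Real.pi_pos])
  positivity

theorem hankelIntegrand_zero_im (x s : ℝ) :
    (hankelIntegrand 0 x s).im =
      Real.exp (-x * s - Real.log ‖hankelPoly s‖ / 2) * Real.sin (x - (hankelPoly s).arg / 2) := by
  rw [hankelIntegrand, hankelKernel_eq, pow_zero, one_mul, ← Complex.exp_add, Complex.exp_im]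
  congr 2
  · simp; ring
  · simp; ring

/-- The integrand has argument `x - arg / 2` with `arg` in `(-π/2, 0)`, hence in `(x, x + π/4)`. For
these `x` its sine has the sign `(-1) ^ k` for every `s`, so nothing cancels. -/
theorem hankelIntegral_im_ne_zero (k : ℕ) {x : ℝ} (hx : 0 < x) (h1 : k * Real.pi ≤ x)
    (h2 : x ≤ k * Real.pi + 3 * Real.pi / 4) : (hankelIntegral 0 x).im ≠ 0 := by
  have hpos : ∀ s : ℝ, 0 < s → 0 < (-1) ^ k * (hankelIntegrand 0 x s).im := by
    intro s hs
    obtain ⟨h3, h4⟩ := arg_hankelPoly hs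
    have h5 := Real.sin_pos_of_pos_of_lt_pi (x := x - (hankelPoly s).arg / 2 - k * Real.pi)
      (by linarith) (by linarith)
    rw [Real.sin_sub_nat_mul_pi] at h5
    rw [hankelIntegrand_zero_im, mul_left_comm]
    positivity
  have hint := integrableOn_hankelIntegrand (j := 0) (by norm_num) hx
  have him : IntegrableOn (fun s => (-1) ^ k * (hankelIntegrand 0 x s).im) (Ioi 0) :=
    hint.im.const_mul _
  have h6 : 0 < ∫ s in Ioi (0 : ℝ), (-1) ^ k * (hankelIntegrand 0 x s).im := by
    rw [setIntegral_pos_iff_support_of_nonneg_ae _ him]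
    · have : Function.support (fun s => (-1) ^ k * (hankelIntegrand 0 x s).im) ∩ Ioi 0 = Ioi 0 :=
        inter_eq_right.2 fun s hs => (hpos s hs).ne'
      rw [this]
      simp
    · filter_upwards [ae_restrict_mem measurableSet_Ioi] with s hs using (hpos s hs).le
  rw [integral_const_mul] at h6
  have h7 : ∫ s in Ioi (0 : ℝ), (hankelIntegrand 0 x s).im = (hankelIntegral 0 x).im :=
    integral_im hint
  rw [h7] at h6
  intro h0
  rw [h0, mul_zero] at h6
  exact lt_irrefl _ h6

/-- A bound `s^(-1/2)` on the amplitude makes the integral `O(x^(-1/2))`, by the Gamma integral.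
This controls the Wronskian with `J₀` at the origin. -/
theorem tendsto_mul_integral_exp_hankel {h : ℝ → ℂ} {C : ℝ}
    (hC : ∀ s : ℝ, 0 < s → ‖h s‖ ≤ C * s ^ (-(1 / 2) : ℝ)) :
    Tendsto (fun x : ℝ => (x : ℂ) * ∫ s in Ioi (0 : ℝ), Complex.exp ((Complex.I - s) * x) * h s)
      (𝓝[>] 0) (𝓝 0) := by
  have hlim : Tendsto (fun x : ℝ => C * Real.Gamma (1 / 2) * (x ^ (-(1 / 2) : ℝ) * x))
      (𝓝[>] 0) (𝓝 0) := by
    simpa using tendsto_rpow_neg_half_mul_self.const_mul (C * Real.Gamma (1 / 2))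
  refine squeeze_zero_norm' ?_ hlim
  filter_upwards [self_mem_nhdsWithin] with x hx
  have hx : 0 < x := hx
  have hint : IntegrableOn (fun s : ℝ => s ^ (-(1 / 2) : ℝ) * Real.exp (-x * s)) (Ioi 0) := by
    simpa using integrableOn_rpow_mul_exp_neg_mul_rpow (s := -(1 / 2)) (by norm_num) one_pos hx
  have hval : ∫ s in Ioi (0 : ℝ), s ^ (-(1 / 2) : ℝ) * Real.exp (-x * s) =
      x ^ (-(1 / 2) : ℝ) * Real.Gamma (1 / 2) := by
    have := Real.integral_rpow_mul_exp_neg_mul_Ioi (a := 1 / 2) (by norm_num) hx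
    rw [show (1 / 2 - 1 : ℝ) = -(1 / 2) by norm_num] at this
    rw [Real.rpow_neg hx.le, ← Real.inv_rpow hx.le, ← one_div, ← this]
    simp only [neg_mul]
  rw [norm_mul, Complex.norm_real, Real.norm_of_nonneg hx.le]
  have := norm_integral_le_of_norm_le (hint.const_mul C)
    (f := fun s : ℝ => Complex.exp ((Complex.I - s) * x) * h s) (by
      filter_upwards [ae_restrict_mem measurableSet_Ioi] with s hs
      rw [norm_mul, norm_exp_hankel]
      calc _ ≤ Real.exp (-x * s) * (C * s ^ (-(1 / 2) : ℝ)) := by gcongr; exact hC s hs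
        _ = _ := by ring)
  rw [integral_const_mul, hval] at this
  calc _ ≤ x * (C * (x ^ (-(1 / 2) : ℝ) * Real.Gamma (1 / 2))) := by gcongr
    _ = _ := by ring

theorem tendsto_mul_hankelIntegral_zero :
    Tendsto (fun x : ℝ => (x : ℂ) * hankelIntegral 0 x) (𝓝[>] 0) (𝓝 0) := by
  have := tendsto_mul_integral_exp_hankel (h := hankelKernel) (C := 1)
    fun s hs => by simpa using norm_hankelKernel_le hs
  refine this.congr fun x => ?_
  simp [hankelIntegral, hankelIntegrand]

/-- Write `K` for the kernel and `ζ = i - s`. For large `s`, `ζ K` is close to `-1`: the product `(1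
+ ζ K) (1 - ζ K)` is the inverse of the polynomial, and `1 - ζ K` has real part at least `1`. -/
theorem norm_one_add_I_sub_mul_hankelKernel_le {s : ℝ} (hs : 0 < s) :
    ‖1 + (Complex.I - s) * hankelKernel s‖ ≤ 3 * s ^ (-(1 / 2) : ℝ) := by
  rcases le_total s 1 with h1 | h1
  · have h2 : 1 ≤ s ^ (-(1 / 2) : ℝ) := Real.one_le_rpow_of_pos_of_le_one_of_nonpos hs h1 (by norm_num)
    calc _ ≤ ‖(1 : ℂ)‖ + ‖Complex.I - s‖ * ‖hankelKernel s‖ := by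
          rw [← norm_mul]; exact norm_add_le _ _
      _ ≤ s ^ (-(1 / 2) : ℝ) + 2 * s ^ (-(1 / 2) : ℝ) := by
          rw [norm_one]
          gcongr
          · exact (norm_I_sub_le hs).trans (by linarith)
          · exact norm_hankelKernel_le hs
      _ = _ := by ring
  · have hP := hankelPoly_ne_zero hs
    have e : (1 + (Complex.I - s) * hankelKernel s) * (1 - (Complex.I - s) * hankelKernel s) =
        (hankelPoly s)⁻¹ := by
      have e1 : (1 + (Complex.I - s) * hankelKernel s) * (1 - (Complex.I - s) * hankelKernel s) =
        1 - (Complex.I - s) ^ 2 * hankelKernel s ^ 2 := by ring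
      have e2 : (Complex.I - s) ^ 2 = hankelPoly s - 1 := by
        rw [hankelPoly]; ring_nf; rw [Complex.I_sq]; ring
      rw [e1, hankelKernel_sq hs, e2]
      field_simp
      ring
    have h2 : 1 ≤ ‖1 - (Complex.I - s) * hankelKernel s‖ := by
      refine le_trans ?_ (Complex.re_le_norm _)
      have := hankelKernel_re_pos hs
      have := hankelKernel_im_pos hs
      simp
      nlinarith
    have h3 : ‖1 + (Complex.I - s) * hankelKernel s‖ ≤ ‖(hankelPoly s)⁻¹‖ := by
      rw [← e, norm_mul]
      exact le_mul_of_one_le_right (norm_nonneg _) h2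
    refine h3.trans ?_
    rw [norm_inv]
    have h4 : ‖hankelPoly s‖⁻¹ ≤ s⁻¹ := inv_anti₀ hs (by linarith [two_mul_le_norm_hankelPoly hs])
    have h5 : s⁻¹ ≤ s ^ (-(1 / 2) : ℝ) := by
      rw [← Real.rpow_neg_one]
      exact Real.rpow_le_rpow_of_exponent_le h1 (by norm_num)
    have : 0 ≤ s ^ (-(1 / 2) : ℝ) := by positivity
    linarith

/-- Replacing `ζ K` by its value `-1` at infinity contributes `-e^(i x)`, which does not tend to
zero, but its imaginary part `-sin x` does. The remainder is covered by the previous two lemmas. -/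
theorem tendsto_mul_hankelIntegral_one_im :
    Tendsto (fun x : ℝ => x * (hankelIntegral 1 x).im) (𝓝[>] 0) (𝓝 0) := by
  have h1 := tendsto_mul_integral_exp_hankel
    (h := fun s => 1 + (Complex.I - s) * hankelKernel s) (C := 3)
    fun s hs => norm_one_add_I_sub_mul_hankelKernel_le hs
  have h2 : Tendsto (fun x : ℝ => -Real.sin x) (𝓝[>] 0) (𝓝 0) := by
    have : Tendsto (fun x : ℝ => -Real.sin x) (𝓝 0) (𝓝 (-Real.sin 0)) :=
      (Continuous.tendsto (by fun_prop) 0)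
    rw [Real.sin_zero, neg_zero] at this
    exact this.mono_left nhdsWithin_le_nhds
  have h3 := ((Complex.continuous_im.tendsto 0).comp h1).add h2
  rw [Complex.zero_im, add_zero] at h3
  refine h3.congr' ?_
  filter_upwards [self_mem_nhdsWithin] with x hx
  have hx : 0 < x := hx
  have e : ∀ s : ℝ, Complex.exp ((Complex.I - s) * x) =
      Complex.exp (Complex.I * x) * Complex.exp (-x * s : ℂ) := by
    intro s; rw [← Complex.exp_add]; congr 1; ring
  have hre : (-x : ℂ).re < 0 := by simpa using hx
  have hi1 : IntegrableOn (fun s : ℝ => Complex.exp ((Complex.I - s) * x)) (Ioi 0) := by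
    simp only [e]
    exact (integrableOn_exp_mul_complex_Ioi hre 0).const_mul _
  have hv1 : ∫ s in Ioi (0 : ℝ), Complex.exp ((Complex.I - s) * x) =
      Complex.exp (Complex.I * x) / x := by
    simp only [e]
    rw [integral_const_mul, integral_exp_mul_complex_Ioi hre]
    simp [div_eq_mul_inv]
  have hi2 := integrableOn_hankelIntegrand (j := 1) (by norm_num) hx
  have hsum : ∫ s in Ioi (0 : ℝ), Complex.exp ((Complex.I - s) * x) *
      (1 + (Complex.I - s) * hankelKernel s) =
      Complex.exp (Complex.I * x) / x + hankelIntegral 1 x := by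
    rw [← hv1, hankelIntegral, ← integral_add hi1 hi2]
    refine integral_congr_ae (Eventually.of_forall fun s => ?_)
    simp [hankelIntegrand, mul_add]
  have hxc : (x : ℂ) ≠ 0 := by exact_mod_cast hx.ne'
  simp only [Function.comp_apply]
  rw [hsum, mul_add, mul_div_cancel₀ _ hxc, Complex.add_im, Complex.im_ofReal_mul, mul_comm Complex.I,
    Complex.exp_ofReal_mul_I_im]
  ring

/-- The imaginary part of the contour integral is proportional to `J₀`. -/
theorem hankelIntegral_wronskian {x : ℝ} (hx : 0 < x) :
    (hankelIntegral 0 x).im * besselE 0 x = x * (hankelIntegral 1 x).im * besselJ 0 x := by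
  set W : ℝ → ℝ := fun x => (hankelIntegral 0 x).im * besselE 0 x -
    x * (hankelIntegral 1 x).im * besselJ 0 x with hW
  have him : ∀ j ≤ 1, ∀ t : ℝ, 0 < t →
      HasDerivAt (fun t => (hankelIntegral j t).im) (hankelIntegral (j + 1) t).im t := by
    intro j hj t ht
    exact Complex.imCLM.hasFDerivAt.comp_hasDerivAt t (hasDerivAt_hankelIntegral hj ht)
  have hd : ∀ t ∈ Ioi (0 : ℝ), HasDerivAt W 0 t := by
    intro t ht
    have ht : 0 < t := ht
    have h0 := him 0 (by norm_num) t ht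
    have h1 := him 1 le_rfl t ht
    refine ((h0.mul (hasDerivAt_besselE 0 ht.ne')).sub
      (((hasDerivAt_id t).mul h1).mul (hasDerivAt_besselJ 0 ht.ne'))).congr_deriv ?_
    have hode := congrArg Complex.im (hankelIntegral_ode ht)
    simp only [Complex.add_im, Complex.im_ofReal_mul, Complex.zero_im] at hode
    simp only [id, Pi.mul_apply]
    norm_num
    field_simp
    linear_combination (-(besselJ 0 t)) * hode
  have hconst : ∀ t ∈ Ioi (0 : ℝ), W t = W x := fun t ht =>
    (convex_Ioi 0).is_const_of_fderivWithin_eq_zero (𝕜 := ℝ)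
      (fun y hy => (hd y hy).differentiableAt.differentiableWithinAt)
      (fun y hy => by
        have h := (hd y hy).hasFDerivAt.hasFDerivWithinAt (s := Ioi 0)
        rw [h.fderivWithin (isOpen_Ioi.uniqueDiffWithinAt hy)]
        ext; simp) ht hx
  -- The constant value of the Wronskian is read off at the origin, where `besselE 0 t` carries a
  -- factor `t` and `t * (hankelIntegral 1 t).im` tends to `0`.
  have hlim : Tendsto W (𝓝[>] 0) (𝓝 0) := by
    have hE : ∀ t : ℝ, besselE 0 t = t * (-(t / 2) * besselSeries 1 (t ^ 2 / 4)) := by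
      intro t; simp [besselE]; ring
    have hc : Tendsto (fun t : ℝ => -(t / 2) * besselSeries 1 (t ^ 2 / 4)) (𝓝[>] 0)
        (𝓝 (-(0 / 2) * besselSeries 1 (0 ^ 2 / 4))) := by
      have := continuous_besselSeries 1
      exact (Continuous.tendsto (by fun_prop) 0).mono_left nhdsWithin_le_nhds
    have h1 := ((Complex.continuous_im.tendsto 0).comp tendsto_mul_hankelIntegral_zero).mul hc
    have h2 := tendsto_mul_hankelIntegral_one_im.mul
      (((continuous_besselJ 0).tendsto 0).mono_left nhdsWithin_le_nhds)
    have h3 := h1.sub h2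
    simp only [Complex.zero_im, zero_mul, sub_zero] at h3
    refine h3.congr fun t => ?_
    simp only [hW, hE, Function.comp_apply, Complex.im_ofReal_mul]
    ring
  have hlim' : Tendsto W (𝓝[>] 0) (𝓝 (W x)) := by
    refine tendsto_const_nhds.congr' ?_
    filter_upwards [self_mem_nhdsWithin] with t ht using (hconst t ht).symm
  exact sub_eq_zero.1 (tendsto_nhds_unique hlim' hlim)

theorem besselJ_zero_ne_zero (k : ℕ) {x : ℝ} (hx : 0 < x) (h1 : k * Real.pi ≤ x)
    (h2 : x ≤ k * Real.pi + 3 * Real.pi / 4) : besselJ 0 x ≠ 0 := by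
  intro h0
  have := hankelIntegral_wronskian hx
  rw [h0, mul_zero, mul_eq_zero] at this
  exact this.elim (hankelIntegral_im_ne_zero k hx h1 h2) (besselJ_ne_zero_or 0 hx h0)

/-- All zeros of `J₀` lie in the last quarters of the intervals `[kπ, (k + 1)π]`, at most one in
each. Two in one quarter would enclose a zero of `J₁` by Rolle, too close to the first of them for
the quarter-period estimate. -/
theorem besselZeroBound_zero : BesselZeroBound 0 := by
  intro ε hε
  have hpi := Real.pi_pos
  refine ⟨0, fun x hx S hS => ?_⟩
  rcases S.eq_empty_or_nonempty with rfl | hne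
  · have : 0 ≤ x / Real.pi := by positivity
    simp only [Finset.card_empty, Nat.cast_zero]
    linarith
  have hfl : ∀ s ∈ S, ⌊s / Real.pi⌋₊ * Real.pi + 3 * Real.pi / 4 < s ∧
      s < (⌊s / Real.pi⌋₊ + 1) * Real.pi := by
    intro s hs
    obtain ⟨h0, -, hJ⟩ := hS s hs
    have h1 : ⌊s / Real.pi⌋₊ * Real.pi ≤ s := by
      rw [← le_div_iff₀ hpi]; exact Nat.floor_le (by positivity)
    constructor
    · by_contra! h2
      exact besselJ_zero_ne_zero _ h0 h1 h2 hJ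
    · rw [← div_lt_iff₀ hpi]; exact Nat.lt_floor_add_one _
  have hinj : ∀ a ∈ S, ∀ b ∈ S, a < b → ⌊a / Real.pi⌋₊ ≠ ⌊b / Real.pi⌋₊ := by
    intro a ha b hb hab heq
    obtain ⟨ha1, -⟩ := hfl a ha
    obtain ⟨-, hb2⟩ := hfl b hb
    rw [← heq] at hb2
    have ha0 := (hS a ha).1
    obtain ⟨y, hy, hy0⟩ := exists_hasDerivAt_eq_zero (f := fun x => besselSeries 0 (x ^ 2 / 4)) hab
      (fun x _ => (hasDerivAt_besselSeries_sq 0 x).continuousAt.continuousWithinAt)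
      (((besselJ_zero_iff 0 ha0).1 (hS a ha).2.2).trans
        ((besselJ_zero_iff 0 (ha0.trans hab)).1 (hS b hb).2.2).symm)
      fun x _ => hasDerivAt_besselSeries_sq 0 x
    have hy1 : 0 < y := ha0.trans hy.1
    have hJ1 : besselJ 1 y = 0 := by
      rw [besselJ_zero_iff 1 hy1]
      rw [neg_eq_zero] at hy0
      exact (mul_eq_zero.1 hy0).resolve_left (by positivity)
    have hq := besselJ_quarter_period 0 ha0 hy.1 (hS a ha).2.2 hJ1
    have hpi3 := Real.pi_gt_three
    have h0 : (0 : ℝ) ≤ ⌊a / Real.pi⌋₊ * Real.pi := by positivity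
    -- From `a > 3π/4`. The damping factor is then at most `5/4`, and `(5/4) (π/4) < π/2`.
    have ha2 : 2 ≤ a := by linarith
    have h3 : (2 * ((0 : ℕ) : ℝ) + 1) / (2 * a) ≤ 1 / 4 := by
      rw [div_le_iff₀ (by positivity)]; norm_num; linarith
    have h4 : y - a ≤ Real.pi / 4 := by linarith [hy.2]
    have h5 : 0 < y - a := sub_pos.2 hy.1
    nlinarith
  have hy := S.max'_mem hne
  have hmax : ∀ s ∈ S, s ≤ S.max' hne := fun s hs => S.le_max' s hs
  set y := S.max' hne
  have hcard : S.card ≤ (Finset.range (⌊y / Real.pi⌋₊ + 1)).card := by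
    refine Finset.card_le_card_of_injOn (fun s => ⌊s / Real.pi⌋₊) (fun s hs => ?_) ?_
    · rw [Finset.coe_range, Set.mem_Iio, Nat.lt_succ_iff]
      exact Nat.floor_le_floor (by have := hmax s hs; gcongr)
    · intro a ha b hb hab
      by_contra hne'
      rcases lt_or_gt_of_ne hne' with h | h
      · exact hinj a ha b hb h hab
      · exact hinj b hb a ha h hab.symm
  rw [Finset.card_range] at hcard
  have hcard' : (S.card : ℝ) ≤ ⌊y / Real.pi⌋₊ + 1 := by exact_mod_cast hcard
  have h1 := (hfl y hy).1
  have h2 : (⌊y / Real.pi⌋₊ : ℝ) + 3 / 4 ≤ x / Real.pi := by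
    rw [le_div_iff₀ hpi]
    linarith [(hS y hy).2.1]
  norm_num
  linarith

theorem besselZeroBound (m : ℕ) : BesselZeroBound m := by
  induction m with
  | zero => exact besselZeroBound_zero
  | succ m ih => exact ih.succ

/-- If `J_m` has `k ≥ 1` zeros in `(0, x]`, then `x > m` and `π (k - 1/4)` is at most the Debye
phase at `x`. -/
theorem card_besselJ_zeros_le (m : ℕ) (S : Finset ℝ) {x : ℝ}
    (hS : ∀ s ∈ S, 0 < s ∧ s ≤ x ∧ besselJ m s = 0) (hne : S.Nonempty) :
    (m : ℝ) < x ∧ Real.pi * (S.card - 1 / 4) ≤ debyePhase m x :=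
  (besselZeroBound m).card_le S hS hne

/-! ### Bessel zeros and lattice points -/

theorem isCompact_kuznecovFedosovDomain : IsCompact kuznecovFedosovDomain := by
  have hpi := Real.pi_pos
  have hsub : kuznecovFedosovDomain ⊆ Icc (-1) 1 ×ˢ Icc 0 2 := by
    rintro ⟨x, y⟩ ⟨h1, h2, h3, h4⟩
    refine ⟨⟨h1, h2⟩, (le_max_left _ _).trans h3, h4.trans ?_⟩
    rw [one_div, ← div_eq_inv_mul, div_le_iff₀ hpi]
    have e1 : √(1 - x ^ 2) ≤ 1 := Real.sqrt_le_one.2 (by nlinarith [sq_nonneg x])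
    have e2 := Real.arccos_nonneg x
    have e3 := Real.arccos_le_pi x
    simp only at h1 h2
    have : -x * Real.arccos x ≤ 1 * Real.arccos x := by gcongr; linarith
    linarith [Real.pi_gt_three]
  refine (isCompact_Icc.prod isCompact_Icc).of_isClosed_subset ?_ hsub
  have e : kuznecovFedosovDomain = {p : ℝ × ℝ | -1 ≤ p.1} ∩ ({p | p.1 ≤ 1} ∩
    ({p | max 0 (-p.1) ≤ p.2} ∩
      {p | p.2 ≤ (1 / Real.pi) * (√(1 - p.1 ^ 2) - p.1 * Real.arccos p.1)})) := rfl
  rw [e]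
  have := Real.continuous_arccos
  refine (isClosed_le (by fun_prop) (by fun_prop)).inter ((isClosed_le (by fun_prop)
    (by fun_prop)).inter ((isClosed_le (by fun_prop) (by fun_prop)).inter
      (isClosed_le (by fun_prop) (by fun_prop))))

theorem bounds_of_mem_kuznecovFedosovDomain {p : ℝ × ℝ} (h : p ∈ kuznecovFedosovDomain) :
    |p.1| ≤ 1 ∧ |p.2| ≤ 2 := by
  obtain ⟨h1, h2, h3, h4⟩ := h
  refine ⟨abs_le.2 ⟨h1, h2⟩, abs_le.2 ⟨by linarith [(le_max_left _ _).trans h3], h4.trans ?_⟩⟩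
  rw [one_div, ← div_eq_inv_mul, div_le_iff₀ Real.pi_pos]
  have e1 : √(1 - p.1 ^ 2) ≤ 1 := Real.sqrt_le_one.2 (by nlinarith [sq_nonneg p.1])
  have e2 := Real.arccos_nonneg p.1
  have e3 := Real.arccos_le_pi p.1
  have : -p.1 * Real.arccos p.1 ≤ 1 * Real.arccos p.1 := by gcongr; linarith
  linarith [Real.pi_gt_three]

/-- The factors `s` in `[r, r + 1]` with `v ∈ s • D` form the projection of a compact set, hence a
closed set. -/
theorem eventually_notMem_smul {D : Set (ℝ × ℝ)} (hD : IsCompact D) {r : ℝ} {v : ℝ × ℝ}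
    (hv : v ∉ r • D) : ∀ᶠ s in 𝓝[>] r, v ∉ s • D := by
  have hK : IsCompact ((Icc r (r + 1) ×ˢ D) ∩ {q : ℝ × (ℝ × ℝ) | q.1 • q.2 = v}) :=
    (isCompact_Icc.prod hD).inter_right (isClosed_eq (by fun_prop) continuous_const)
  have hC := (hK.image continuous_fst).isClosed
  have hr : r ∈ (Prod.fst '' ((Icc r (r + 1) ×ˢ D) ∩ {q : ℝ × (ℝ × ℝ) | q.1 • q.2 = v}))ᶜ := by
    rintro ⟨⟨s, d⟩, ⟨⟨-, hd⟩, hq⟩, rfl⟩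
    exact hv ⟨d, hd, hq⟩
  filter_upwards [nhdsWithin_le_nhds (hC.isOpen_compl.mem_nhds hr),
    Ioo_mem_nhdsGT (show r < r + 1 by linarith)] with s hs hs'
  rintro ⟨d, hd, hq⟩
  exact hs ⟨(s, d), ⟨⟨Ioo_subset_Icc_self hs', hd⟩, hq⟩, rfl⟩

/-- Only finitely many lattice points can occur for `s < r + 1`, and those absent at `r` are absent
for `s` slightly larger. This recovers `r` itself from the variational argument, which needs a
strictly larger parameter. -/
theorem le_latticeCounting_of_forall_gt {r : ℝ} (hr : 0 ≤ r) {N : ℕ∞}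
    (h : ∀ s, r < s → N ≤ latticeCounting s) : N ≤ latticeCounting r := by
  set M : ℤ := ⌈2 * (r + 1) + 1⌉
  have hM : 2 * (r + 1) + 1 ≤ M := Int.le_ceil _
  have hfin : (Icc (-M) M ×ˢ Icc (-M) M : Set (ℤ × ℤ)).Finite :=
    (finite_Icc _ _).prod (finite_Icc _ _)
  have hev : ∀ᶠ s in 𝓝[>] r, ∀ p ∈ (Icc (-M) M ×ˢ Icc (-M) M : Set (ℤ × ℤ)),
      ((p.1 : ℝ), (p.2 : ℝ) - 1 / 4) ∉ r • kuznecovFedosovDomain →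
        ((p.1 : ℝ), (p.2 : ℝ) - 1 / 4) ∉ s • kuznecovFedosovDomain := by
    rw [eventually_all_finite hfin]
    intro p _
    by_cases hp : ((p.1 : ℝ), (p.2 : ℝ) - 1 / 4) ∈ r • kuznecovFedosovDomain
    · exact Eventually.of_forall fun s h => absurd hp h
    · filter_upwards [eventually_notMem_smul isCompact_kuznecovFedosovDomain hp] with s hs _ using hs
  obtain ⟨s, hs, hs'⟩ := (hev.and (Ioo_mem_nhdsGT (show r < r + 1 by linarith))).exists
  refine (h s hs'.1).trans (encard_le_encard fun p hp => ?_)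
  by_contra hp'
  refine hs p ?_ hp' hp
  obtain ⟨d, hd, hdp⟩ := hp
  obtain ⟨b1, b2⟩ := bounds_of_mem_kuznecovFedosovDomain hd
  have hs0 : 0 ≤ s := hr.trans hs'.1.le
  have hs1 := hs'.2
  have e1 : s * d.1 = p.1 := congrArg Prod.fst hdp
  have e2 : s * d.2 = p.2 - 1 / 4 := congrArg Prod.snd hdp
  have c1 : |(p.1 : ℝ)| ≤ s * 1 := by rw [← e1, abs_mul, abs_of_nonneg hs0]; gcongr
  have c2 : |(p.2 : ℝ) - 1 / 4| ≤ s * 2 := by rw [← e2, abs_mul, abs_of_nonneg hs0]; gcongr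
  rw [abs_le] at c1 c2
  refine ⟨⟨?_, ?_⟩, ?_, ?_⟩
  · have : -(M : ℝ) ≤ p.1 := by linarith
    exact_mod_cast this
  · have : (p.1 : ℝ) ≤ M := by linarith
    exact_mod_cast this
  · have : -(M : ℝ) ≤ p.2 := by linarith
    exact_mod_cast this
  · have : (p.2 : ℝ) ≤ M := by linarith
    exact_mod_cast this

theorem finite_besselJ_zeros (m : ℕ) (x : ℝ) : {t | 0 < t ∧ t ≤ x ∧ besselJ m t = 0}.Finite := by
  by_contra hinf
  obtain ⟨N, hN⟩ := exists_nat_gt (debyePhase m x / Real.pi + 1 / 4)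
  obtain ⟨S, hS, hcard⟩ := Set.Infinite.exists_subset_card_eq hinf (N + 1)
  have hne : S.Nonempty := Finset.card_pos.1 (by omega)
  have := (card_besselJ_zeros_le m S (fun s hs => hS hs) hne).2
  rw [hcard, mul_comm, ← le_div_iff₀ Real.pi_pos] at this
  push_cast at this
  linarith

/-- At abscissa `n / s` the upper boundary, multiplied by `π s`, is the Debye phase of order `|n|`
if `n ≥ 0`. For `n < 0` the reflection `arccos (-t) = π - arccos t` adds `π |n|`, which is the shift
of `k` by `max 0 (-n)`. The lower boundary needs only `k ≥ 1`. -/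
theorem mem_smul_kuznecovFedosovDomain {n : ℤ} {k : ℕ} {s : ℝ} (hk : 1 ≤ k)
    (hn : (n.natAbs : ℝ) < s) (h : Real.pi * (k - 1 / 4) ≤ debyePhase n.natAbs s) :
    ((n : ℝ), ((k + max 0 (-n) : ℤ) : ℝ) - 1 / 4) ∈ s • kuznecovFedosovDomain := by
  have hpi := Real.pi_pos
  have hs : 0 < s := (Nat.cast_nonneg _).trans_lt hn
  have hk' : (1 : ℝ) ≤ k := by exact_mod_cast hk
  have habs : (n.natAbs : ℝ) = |(n : ℝ)| := by
    rw [Nat.cast_natAbs, Int.cast_abs]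
  rw [habs] at hn h
  have hn' := abs_lt.1 hn
  rw [mem_smul_set_iff_inv_smul_mem₀ hs.ne']
  have hsq : √(s ^ 2 - |(n : ℝ)| ^ 2) = s * √(1 - (s⁻¹ * n) ^ 2) := by
    rw [sq_abs, show s ^ 2 - (n : ℝ) ^ 2 = s ^ 2 * (1 - (s⁻¹ * n) ^ 2) by field_simp,
      Real.sqrt_mul (by positivity), Real.sqrt_sq hs.le]
  have hφ : debyePhase |(n : ℝ)| s =
      s * (√(1 - (s⁻¹ * n) ^ 2) - s⁻¹ * n * Real.arccos (s⁻¹ * n)) -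
        Real.pi * max 0 (-(n : ℝ)) := by
    rw [debyePhase, hsq]
    rcases le_total 0 (n : ℝ) with h0 | h0
    · rw [abs_of_nonneg h0, max_eq_left (by linarith), div_eq_inv_mul]
      field_simp
      ring
    · rw [abs_of_nonpos h0, max_eq_right (by linarith), neg_div, Real.arccos_neg, div_eq_inv_mul]
      field_simp
      ring
  simp only [Prod.smul_mk, smul_eq_mul]
  refine ⟨?_, ?_, ?_, ?_⟩
  · rw [← div_eq_inv_mul, le_div_iff₀ hs]; linarith
  · rw [← div_eq_inv_mul, div_le_iff₀ hs]; linarith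
  · push_cast
    rw [← div_eq_inv_mul, ← div_eq_inv_mul, le_div_iff₀ hs]
    rcases le_total 0 (n : ℝ) with h0 | h0
    · rw [max_eq_left (by have : 0 ≤ n / s := by positivity
                          simpa using this), max_eq_left (by linarith)]
      linarith
    · rw [max_eq_right (by rw [← neg_div]; exact div_nonneg (by linarith) hs.le),
        max_eq_right (by linarith), neg_mul, div_mul_cancel₀ _ hs.ne']
      linarith
  · push_cast
    rw [hφ] at h
    rw [inv_mul_le_iff₀ hs, mul_left_comm, one_div_mul_eq_div, le_div_iff₀ hpi]
    linarith

/-- The index set of the modes: orders `n` and zeros in `(0, s)` of `J_|n|`. -/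
def besselZeroSet (s : ℝ) : Set (ℤ × ℝ) := {p | 0 < p.2 ∧ p.2 < s ∧ besselJ p.1.natAbs p.2 = 0}

theorem encard_besselZeroSet_le {s : ℝ} : (besselZeroSet s).encard ≤ latticeCounting s := by
  set Z : ℤ → ℝ → Set ℝ := fun n x => {t | 0 < t ∧ t ≤ x ∧ besselJ n.natAbs t = 0} with hZ
  have hfin : ∀ n x, (Z n x).Finite := fun n x => finite_besselJ_zeros _ _
  -- The cardinality is the rank of the zero among those of its order; it counts the zero itself, so
  -- ranks start at `1`.
  refine encard_le_encard_of_injOn (f := fun p => (p.1, ((Z p.1 p.2).ncard + max 0 (-p.1) : ℤ)))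
    ?_ ?_
  · rintro ⟨n, x⟩ ⟨h0, hxs, hJ⟩
    have hx : x ∈ Z n x := ⟨h0, le_rfl, hJ⟩
    have hS : ∀ t ∈ (hfin n x).toFinset, 0 < t ∧ t ≤ s ∧ besselJ n.natAbs t = 0 := by
      intro t ht
      obtain ⟨a, b, c⟩ := (hfin n x).mem_toFinset.1 ht
      exact ⟨a, b.trans hxs.le, c⟩
    have hne : (hfin n x).toFinset.Nonempty := ⟨x, (hfin n x).mem_toFinset.2 hx⟩
    obtain ⟨c1, c2⟩ := card_besselJ_zeros_le _ _ hS hne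
    rw [← ncard_eq_toFinset_card (Z n x) (hfin n x)] at c2
    exact mem_smul_kuznecovFedosovDomain ((ncard_pos (hfin n x)).2 ⟨x, hx⟩) c1 c2
  · have hlt : ∀ n : ℤ, ∀ x y : ℝ, (n, y) ∈ besselZeroSet s → x < y →
        (Z n x).ncard < (Z n y).ncard := by
      intro n x y hy hxy
      refine ncard_lt_ncard ⟨fun t ht => ⟨ht.1, ht.2.1.trans hxy.le, ht.2.2⟩, fun hsub => ?_⟩ (hfin n y)
      have := hsub (⟨hy.1, le_rfl, hy.2.2⟩ : y ∈ Z n y)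
      exact absurd this.2.1 (not_le.2 hxy)
    rintro ⟨n, x⟩ hx ⟨n', y⟩ hy h
    simp only [Prod.mk.injEq] at h
    obtain ⟨rfl, h⟩ := h
    have h' : (Z n x).ncard = (Z n y).ncard := by omega
    congr 1
    by_contra hne
    rcases lt_or_gt_of_ne hne with hlt' | hlt'
    · exact (hlt n x y hy hlt').ne h'
    · exact (hlt n y x hx hlt').ne' h'

theorem finite_besselZeroSet (s : ℝ) : (besselZeroSet s).Finite := by
  have h : ∀ p ∈ besselZeroSet s, (p.1.natAbs : ℝ) < s := fun p hp =>
    (lt_of_besselJ_eq_zero _ hp.1 hp.2.2).trans hp.2.1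
  have hI : (Icc (-⌈s⌉) ⌈s⌉ : Set ℤ).Finite := finite_Icc _ _
  refine (hI.biUnion (t := fun n => Prod.mk n '' {t | 0 < t ∧ t ≤ s ∧ besselJ n.natAbs t = 0})
    fun n _ => (finite_besselJ_zeros _ _).image _).subset ?_
  rintro ⟨n, x⟩ hp
  have hn : (n.natAbs : ℝ) < ⌈s⌉ := (h _ hp).trans_le (Int.le_ceil s)
  have hn' : ((n.natAbs : ℤ) : ℝ) < ⌈s⌉ := by
    rw [Int.cast_natCast]; exact hn
  rw [Int.cast_lt] at hn'
  simp only [mem_iUnion]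
  exact ⟨n, ⟨by omega, by omega⟩, x, ⟨hp.1, hp.2.1.le, hp.2.2⟩, rfl⟩

/-! ### The radial inequality -/

theorem hasDerivAt_besselJ_mul (m : ℕ) {lam r : ℝ} (hlam : 0 < lam) (hr : 0 < r) :
    HasDerivAt (fun r => besselJ m (lam * r)) (besselE m (lam * r) / r) r := by
  have h : HasDerivAt (fun r : ℝ => lam * r) lam r := by
    simpa using (hasDerivAt_id r).const_mul lam
  refine ((hasDerivAt_besselJ m (mul_pos hlam hr).ne').comp r h).congr_deriv ?_
  field_simp

theorem hasDerivAt_besselE_mul (m : ℕ) {lam r : ℝ} (hlam : 0 < lam) (hr : 0 < r) :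
    HasDerivAt (fun r => besselE m (lam * r))
      ((m ^ 2 / r - lam ^ 2 * r) * besselJ m (lam * r)) r := by
  have h : HasDerivAt (fun r : ℝ => lam * r) lam r := by
    simpa using (hasDerivAt_id r).const_mul lam
  refine ((hasDerivAt_besselE m (mul_pos hlam hr).ne').comp r h).congr_deriv ?_
  field_simp

theorem tendsto_besselE_div_besselJ (m : ℕ) {lam : ℝ} (hlam : 0 < lam) :
    Tendsto (fun r => besselE m (lam * r) / besselJ m (lam * r)) (𝓝[>] 0) (𝓝 m) := by
  have hc0 := continuous_besselSeries m
  have hc1 := continuous_besselSeries (m + 1)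
  have hF0 : besselSeries m ((lam * 0) ^ 2 / 4) ≠ 0 := by
    rw [mul_zero, zero_pow two_ne_zero, zero_div, besselSeries_zero]
    positivity
  have h1 : Tendsto (fun r : ℝ => m - (lam * r) ^ 2 / 2 * besselSeries (m + 1) ((lam * r) ^ 2 / 4) /
      besselSeries m ((lam * r) ^ 2 / 4)) (𝓝 0) (𝓝 (m - (lam * 0) ^ 2 / 2 *
        besselSeries (m + 1) ((lam * 0) ^ 2 / 4) / besselSeries m ((lam * 0) ^ 2 / 4))) :=
    tendsto_const_nhds.sub (Tendsto.div (Continuous.tendsto (by fun_prop) 0)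
      (Continuous.tendsto (by fun_prop) 0) hF0)
  have h2 : ∀ᶠ r : ℝ in 𝓝 0, besselSeries m ((lam * r) ^ 2 / 4) ≠ 0 :=
    (ContinuousAt.eventually_ne (g := fun r : ℝ => besselSeries m ((lam * r) ^ 2 / 4))
      (Continuous.continuousAt (by fun_prop)) hF0)
  rw [mul_zero, zero_pow two_ne_zero, zero_div, zero_mul, zero_div, sub_zero] at h1
  refine (h1.mono_left nhdsWithin_le_nhds).congr' ?_
  filter_upwards [self_mem_nhdsWithin, nhdsWithin_le_nhds h2] with r hr hr2
  have hr : 0 < r := hr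
  have hx : 0 < lam * r := mul_pos hlam hr
  rw [besselE, besselJ]
  generalize besselSeries m ((lam * r) ^ 2 / 4) = F at hr2 ⊢
  generalize besselSeries (m + 1) ((lam * r) ^ 2 / 4) = F₁
  generalize lam * r = x at hx ⊢
  rw [pow_add]
  field_simp

/-- Hardy-type inequality for radial functions vanishing at the zeros of `J_m (λ r)`. -/
theorem radial_bessel_inequality (m : ℕ) {lam : ℝ} (hlam : 0 < lam) {f f' h : ℝ → ℂ}
    (hf : ∀ r, HasDerivAt f (f' r) r) (hf' : Continuous f') (hh : Continuous h)
    (hfh : ∀ r, 0 < r → r * ‖h r‖ = m * ‖f r‖) (h1 : ∀ᶠ r in 𝓝 1, f r = 0)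
    (hz : ∀ r ∈ Ioo (0 : ℝ) 1, besselJ m (lam * r) = 0 → f r = 0) :
    ∫ r in (0 : ℝ)..1, r * (lam ^ 2 * ‖f r‖ ^ 2) ≤
      ∫ r in (0 : ℝ)..1, r * (‖f' r‖ ^ 2 + ‖h r‖ ^ 2) := by
  have hfc : Continuous f := continuous_iff_continuousAt.2 fun r => (hf r).continuousAt
  set j : ℝ → ℝ := fun r => besselJ m (lam * r) with hj
  set e : ℝ → ℝ := fun r => besselE m (lam * r) with he
  have hjc : Continuous j := (continuous_besselJ m).comp (by fun_prop)
  have hec : Continuous e := (continuous_besselE m).comp (by fun_prop)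
  -- Picone's function. Where `j ≠ 0`, the difference `I - B'` is at least `(|e / j| ‖f‖ - r ‖f'‖)²
  -- / r`. As `B` vanishes at `0` and at `1`, integrating `B' ≤ I` gives the claim.
  set B : ℝ → ℝ := fun r => e r / j r * ‖f r‖ ^ 2 with hB
  set I : ℝ → ℝ := fun r => r * (‖f' r‖ ^ 2 + ‖h r‖ ^ 2) - r * (lam ^ 2 * ‖f r‖ ^ 2) with hI
  have hIc : Continuous I := by fun_prop
  have hf0 : (m : ℝ) * ‖f 0‖ ^ 2 = 0 := by
    have t1 : Tendsto (fun r : ℝ => r * ‖h r‖) (𝓝[>] 0) (𝓝 (0 * ‖h 0‖)) :=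
      (Continuous.tendsto (by fun_prop) 0).mono_left nhdsWithin_le_nhds
    have t2 : Tendsto (fun r : ℝ => (m : ℝ) * ‖f r‖) (𝓝[>] 0) (𝓝 (m * ‖f 0‖)) :=
      (Continuous.tendsto (by fun_prop) 0).mono_left nhdsWithin_le_nhds
    have t3 : (m : ℝ) * ‖f 0‖ = 0 := by
      rw [zero_mul] at t1
      refine tendsto_nhds_unique (t2.congr' ?_) t1
      filter_upwards [self_mem_nhdsWithin] with r hr using (hfh r hr).symm
    rw [sq, ← mul_assoc, t3, zero_mul]
  have hB0 : B 0 = 0 := by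
    rcases Nat.eq_zero_or_pos m with rfl | hm
    · simp [hB, he, besselE]
    · simp [hB, hj, besselJ, hm.ne']
  have hB1 : B =ᶠ[𝓝 1] fun _ => 0 := by
    filter_upwards [h1] with r hr
    simp [hB, hr]
  have hder : ∀ r ∈ Ioo (0 : ℝ) 1, ∃ d ≤ I r, HasDerivAt B d r := by
    intro r hr
    have hr0 : 0 < r := hr.1
    have hdj : HasDerivAt j (e r / r) r := hasDerivAt_besselJ_mul m hlam hr0
    by_cases hjr : j r = 0
    -- Here `j` has a simple zero and `‖f‖²` vanishes to second order, so `B`, which is `0` at `r`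
    -- by the convention for division, is differentiable there with derivative `r ‖f'‖²`.
    · have hfr := hz r hr hjr
      have her : e r ≠ 0 := besselJ_ne_zero_or m (mul_pos hlam hr0) hjr
      refine ⟨r * ‖f' r‖ ^ 2, ?_, ?_⟩
      · simp only [hI, hfr, norm_zero]
        have : 0 ≤ r * ‖h r‖ ^ 2 := by positivity
        linarith
      · rw [hasDerivAt_iff_tendsto_slope]
        have s1 := hasDerivAt_iff_tendsto_slope.1 hdj
        have s2 := hasDerivAt_iff_tendsto_slope.1 (hf r)
        have s3 := (((hec.tendsto r).mono_left (nhdsWithin_le_nhds (s := {r}ᶜ))).div s1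
          (div_ne_zero her hr0.ne')).mul (s2.norm.pow 2)
        rw [div_div_cancel₀ her] at s3
        refine s3.congr' ?_
        filter_upwards [self_mem_nhdsWithin] with t ht
        have ht' : t - r ≠ 0 := sub_ne_zero.2 ht
        simp only [Pi.div_apply, slope_def_field, hjr, hB, zero_pow two_ne_zero, slope_def_module, hfr, norm_zero,
          mul_zero, sub_zero, norm_smul, norm_inv, mul_pow, inv_pow, Real.norm_eq_abs, sq_abs]
        field_simp
    · have hd := ((hasDerivAt_besselE_mul m hlam hr0).div hdj hjr).mul (hf r).norm_sq
      refine ⟨_, ?_, hd⟩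
      have hhr : r * ‖h r‖ ^ 2 = m ^ 2 / r * ‖f r‖ ^ 2 := by
        have := hfh r hr0
        field_simp
        rw [← mul_pow, this, mul_pow]
      have hin := abs_real_inner_le_norm (f r) (f' r)
      set p := inner ℝ (f r) (f' r)
      simp only [hI, mul_add, hhr]
      change ((m ^ 2 / r - lam ^ 2 * r) * j r * j r - e r * (e r / r)) / j r ^ 2 * ‖f r‖ ^ 2 +
        e r / j r * (2 * p) ≤ _
      have e1 : ((m ^ 2 / r - lam ^ 2 * r) * j r * j r - e r * (e r / r)) / j r ^ 2 * ‖f r‖ ^ 2 +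
          e r / j r * (2 * p) = m ^ 2 / r * ‖f r‖ ^ 2 - r * (lam ^ 2 * ‖f r‖ ^ 2) -
            ((e r / j r) ^ 2 * ‖f r‖ ^ 2 - 2 * r * (e r / j r * p)) / r := by
        field_simp
        ring
      have e2 : -(r * ‖f' r‖ ^ 2) ≤
          ((e r / j r) ^ 2 * ‖f r‖ ^ 2 - 2 * r * (e r / j r * p)) / r := by
        rw [le_div_iff₀ hr0]
        have e3 : e r / j r * p ≤ |e r / j r| * (‖f r‖ * ‖f' r‖) := by
          refine (le_abs_self _).trans ?_
          rw [abs_mul]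
          gcongr
        have e4 := sq_abs (e r / j r)
        rw [← e4]
        nlinarith [sq_nonneg (|e r / j r| * ‖f r‖ - r * ‖f' r‖)]
      rw [e1]
      linarith
  choose! d hd1 hd2 using hder
  have hBc : ContinuousOn B (Icc 0 1) := by
    intro r hr
    rcases hr.1.eq_or_lt with rfl | hr0
    · have : ContinuousWithinAt B (Ioi 0) 0 := by
        have t : Tendsto B (𝓝[>] 0) (𝓝 (m * ‖f 0‖ ^ 2)) := (tendsto_besselE_div_besselJ m hlam).mul
          (((hfc.norm.pow 2).tendsto 0).mono_left nhdsWithin_le_nhds)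
        rw [ContinuousWithinAt, hB0]
        rwa [hf0] at t
      exact (continuousWithinAt_Ioi_iff_Ici.1 this).mono Icc_subset_Ici_self
    · rcases hr.2.eq_or_lt with rfl | hr1
      · exact (continuousAt_const.congr hB1.symm).continuousWithinAt
      · exact (hd2 r ⟨hr0, hr1⟩).continuousAt.continuousWithinAt
  have key := intervalIntegral.sub_le_integral_of_hasDeriv_right_of_le zero_le_one hBc
    (fun r hr => (hd2 r hr).hasDerivWithinAt) (hIc.integrableOn_Icc) hd1
  have i1 : Continuous fun r : ℝ => r * (‖f' r‖ ^ 2 + ‖h r‖ ^ 2) := by fun_prop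
  have i2 : Continuous fun r : ℝ => r * (lam ^ 2 * ‖f r‖ ^ 2) := by fun_prop
  rw [hB0, hB1.self_of_nhds, sub_zero, intervalIntegral.integral_sub
    (i1.intervalIntegrable _ _) (i2.intervalIntegrable _ _)] at key
  linarith

/-! ### Polar coordinates and angular modes -/

/-- The point with polar coordinates `(r, θ)`. -/
def polarPoint (r θ : ℝ) : ℂ := r * Complex.exp (θ * Complex.I)

theorem continuous_polarPoint : Continuous fun p : ℝ × ℝ => polarPoint p.1 p.2 := by
  unfold polarPoint
  fun_prop

theorem norm_polarPoint (r θ : ℝ) : ‖polarPoint r θ‖ = |r| := by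
  simp [polarPoint, Complex.norm_exp_ofReal_mul_I]

theorem polarCoord_symm_eq_polarPoint (p : ℝ × ℝ) :
    Complex.polarCoord.symm p = polarPoint p.1 p.2 := by
  rw [Complex.polarCoord_symm_apply, polarPoint, Complex.exp_mul_I]
  push_cast
  rfl

theorem arg_polarPoint {r θ : ℝ} (hr : 0 < r) (hθ : θ ∈ Ioo (-Real.pi) Real.pi) :
    (polarPoint r θ).arg = θ := by
  rw [polarPoint, Complex.exp_mul_I]
  exact Complex.arg_mul_cos_add_sin_mul_I hr (Ioo_subset_Ioc_self hθ)

/-- Only the polar expression `K` has to be continuous, so `g` may involve `arg`, which jumps across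
the negative axis. -/
theorem integral_annulus {E : Type*} [NormedAddCommGroup E] [NormedSpace ℝ E] [CompleteSpace E]
    (g : ℂ → E) {ρ : ℝ} (h0 : 0 ≤ ρ) (h1 : ρ ≤ 1) {K : ℝ → ℝ → E}
    (hK : Continuous fun p : ℝ × ℝ => K p.1 p.2)
    (hgK : ∀ r ∈ Ioo ρ 1, ∀ θ ∈ Ioo (-Real.pi) Real.pi, r • g (polarPoint r θ) = K r θ) :
    ∫ z in {z : ℂ | ρ < ‖z‖ ∧ ‖z‖ < 1}, g z = ∫ r in ρ..1, ∫ θ in -Real.pi..Real.pi, K r θ := by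
  have hA : MeasurableSet {z : ℂ | ρ < ‖z‖ ∧ ‖z‖ < 1} :=
    ((isOpen_lt continuous_const continuous_norm).inter
      (isOpen_lt continuous_norm continuous_const)).measurableSet
  rw [← integral_indicator hA, ← Complex.integral_comp_polarCoord_symm]
  have hsub : Ioo ρ 1 ×ˢ Ioo (-Real.pi) Real.pi ⊆ polarCoord.target :=
    prod_mono (fun r hr => h0.trans_lt hr.1) le_rfl
  have e1 : ∀ p ∈ polarCoord.target \ (Ioo ρ 1 ×ˢ Ioo (-Real.pi) Real.pi),
      p.1 • {z : ℂ | ρ < ‖z‖ ∧ ‖z‖ < 1}.indicator g (Complex.polarCoord.symm p) = 0 := by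
    rintro ⟨r, θ⟩ ⟨⟨hr, hθ⟩, hp⟩
    rw [indicator_of_notMem, smul_zero]
    rintro ⟨h2, h3⟩
    rw [Complex.norm_polarCoord_symm, abs_of_pos hr] at h2 h3
    exact hp ⟨⟨h2, h3⟩, hθ⟩
  have e2 : ∀ p ∈ Ioo ρ 1 ×ˢ Ioo (-Real.pi) Real.pi,
      p.1 • {z : ℂ | ρ < ‖z‖ ∧ ‖z‖ < 1}.indicator g (Complex.polarCoord.symm p) = K p.1 p.2 := by
    rintro ⟨r, θ⟩ ⟨hr, hθ⟩
    rw [polarCoord_symm_eq_polarPoint, indicator_of_mem]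
    · exact hgK r hr θ hθ
    · simp only [mem_ofPred_eq, norm_polarPoint, abs_of_pos (h0.trans_lt hr.1)]
      exact hr
  have hint : IntegrableOn (fun p : ℝ × ℝ => K p.1 p.2) (Ioo ρ 1 ×ˢ Ioo (-Real.pi) Real.pi)
      (volume.prod volume) :=
    (hK.continuousOn.integrableOn_compact (μ := volume.prod volume)
      (isCompact_Icc.prod isCompact_Icc)).mono_set
      (prod_mono Ioo_subset_Icc_self Ioo_subset_Icc_self)
  rw [setIntegral_eq_of_subset_of_forall_sdiff_eq_zero
      polarCoord.open_target.measurableSet hsub e1,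
    setIntegral_congr_fun (measurableSet_Ioo.prod measurableSet_Ioo) e2,
    Measure.volume_eq_prod, setIntegral_prod _ hint,
    intervalIntegral.integral_of_le h1, ← integral_Ioc_eq_integral_Ioo]
  refine integral_congr_ae (Eventually.of_forall fun r => ?_)
  simp only
  rw [intervalIntegral.integral_of_le (by linarith [Real.pi_pos]), ← integral_Ioc_eq_integral_Ioo]

theorem unitDisk_ae_eq :
    (unitDisk : Set ℂ) =ᵐ[volume] {z : ℂ | 0 < ‖z‖ ∧ ‖z‖ < 1} := by
  have : (unitDisk : Set ℂ) \ {0} = {z : ℂ | 0 < ‖z‖ ∧ ‖z‖ < 1} := by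
    ext z
    simp [unitDisk, and_comm]
  rw [← this]
  exact (sdiff_null_ae_eq_self (measure_singleton 0)).symm

theorem integral_unitDisk {E : Type*} [NormedAddCommGroup E] [NormedSpace ℝ E] [CompleteSpace E]
    {g : ℂ → E} (hg : Continuous g) :
    ∫ z in (unitDisk : Set ℂ), g z =
      ∫ r in (0 : ℝ)..1, ∫ θ in -Real.pi..Real.pi, r • g (polarPoint r θ) := by
  rw [setIntegral_congr_set unitDisk_ae_eq]
  refine integral_annulus g le_rfl zero_le_one ?_ fun _ _ _ _ => rfl
  exact continuous_fst.smul (hg.comp continuous_polarPoint)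

/-- The `n`-th Fourier coefficient of a function of the angle. -/
def angularMode (n : ℤ) (ψ : ℝ → ℂ) : ℂ :=
  (2 * Real.pi : ℂ)⁻¹ * ∫ θ in -Real.pi..Real.pi, Complex.exp (-(n * θ) * Complex.I) * ψ θ

theorem hasSum_norm_sq_angularMode {ψ : ℝ → ℂ} (hψ : Continuous ψ) :
    HasSum (fun n => ‖angularMode n ψ‖ ^ 2)
      ((2 * Real.pi)⁻¹ * ∫ θ in -Real.pi..Real.pi, ‖ψ θ‖ ^ 2) := by
  have hab : -Real.pi < Real.pi := by linarith [Real.pi_pos]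
  have hL : MemLp ψ 2 (volume.restrict (Ioc (-Real.pi) Real.pi)) :=
    (memLp_two_iff_integrable_sq_norm hψ.aestronglyMeasurable).2
      (((hψ.norm.pow 2).integrableOn_Icc).mono_set Ioc_subset_Icc_self)
  have h := hasSum_sq_fourierCoeffOn hab hL
  have e : ∀ n, fourierCoeffOn hab ψ n = angularMode n ψ := by
    intro n
    rw [fourierCoeffOn_eq_integral, angularMode]
    rw [Complex.real_smul]
    congr 1
    · push_cast; ring
    · refine intervalIntegral.integral_congr fun θ _ => ?_
      simp only [fourier_coe_apply, smul_eq_mul]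
      congr 2
      have : (Real.pi : ℂ) ≠ 0 := by exact_mod_cast Real.pi_ne_zero
      push_cast
      field_simp
      ring
  simp only [e, smul_eq_mul] at h
  rwa [show Real.pi - -Real.pi = 2 * Real.pi by ring] at h

theorem continuous_angularMode (n : ℤ) {F : ℝ → ℝ → ℂ}
    (hF : Continuous fun p : ℝ × ℝ => F p.1 p.2) : Continuous fun r => angularMode n (F r) := by
  unfold angularMode
  refine continuous_const.mul ?_
  refine intervalIntegral.continuous_parametric_intervalIntegral_of_continuous' ?_ _ _
  exact Continuous.mul (by fun_prop) hF

/-- Tonelli in `ℝ≥0∞` exchanges sum and integral, so summability of the integrals never has to be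
established. -/
theorem integral_le_of_hasSum {a b : ℤ → ℝ → ℝ} {A B : ℝ → ℝ}
    (ha : ∀ n, Continuous (a n)) (hb : ∀ n, Continuous (b n)) (hA : Continuous A)
    (hB : Continuous B) (ha0 : ∀ n, ∀ r ∈ Ioc (0 : ℝ) 1, 0 ≤ a n r)
    (hb0 : ∀ n, ∀ r ∈ Ioc (0 : ℝ) 1, 0 ≤ b n r)
    (hsa : ∀ r, HasSum (fun n => a n r) (A r)) (hsb : ∀ r, HasSum (fun n => b n r) (B r))
    (hab : ∀ n, ∫ r in (0 : ℝ)..1, a n r ≤ ∫ r in (0 : ℝ)..1, b n r) :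
    ∫ r in (0 : ℝ)..1, A r ≤ ∫ r in (0 : ℝ)..1, B r := by
  have key : ∀ {c : ℤ → ℝ → ℝ} {C : ℝ → ℝ}, (∀ n, Continuous (c n)) → Continuous C →
      (∀ n, ∀ r ∈ Ioc (0 : ℝ) 1, 0 ≤ c n r) → (∀ r, HasSum (fun n => c n r) (C r)) →
      ENNReal.ofReal (∫ r in (0 : ℝ)..1, C r) =
        ∑' n, ENNReal.ofReal (∫ r in (0 : ℝ)..1, c n r) := by
    intro c C hc hC hc0 hs
    have hint : ∀ {d : ℝ → ℝ}, Continuous d → IntegrableOn d (Ioc 0 1) := fun hd =>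
      hd.integrableOn_Icc.mono_set Ioc_subset_Icc_self
    have hae : ∀ n, 0 ≤ᵐ[volume.restrict (Ioc (0 : ℝ) 1)] c n := fun n => by
      filter_upwards [ae_restrict_mem measurableSet_Ioc] with r hr using hc0 n r hr
    have hCae : 0 ≤ᵐ[volume.restrict (Ioc (0 : ℝ) 1)] C := by
      filter_upwards [ae_restrict_mem measurableSet_Ioc] with r hr
      exact (hs r).nonneg fun n => hc0 n r hr
    simp only [intervalIntegral.integral_of_le zero_le_one]
    rw [ofReal_integral_eq_lintegral_ofReal (hint hC) hCae]
    simp only [ofReal_integral_eq_lintegral_ofReal (hint (hc _)) (hae _)]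
    rw [← lintegral_tsum fun n => (hc n).measurable.ennreal_ofReal.aemeasurable]
    refine lintegral_congr_ae ?_
    filter_upwards [ae_restrict_mem measurableSet_Ioc] with r hr
    rw [← ENNReal.ofReal_tsum_of_nonneg (fun n => hc0 n r hr) (hs r).summable, (hs r).tsum_eq]
  have h1 := key ha hA ha0 hsa
  have h2 := key hb hB hb0 hsb
  have h3 : ENNReal.ofReal (∫ r in (0 : ℝ)..1, A r) ≤ ENNReal.ofReal (∫ r in (0 : ℝ)..1, B r) := by
    rw [h1, h2]
    exact ENNReal.tsum_le_tsum fun n => ENNReal.ofReal_le_ofReal (hab n)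
  refine (ENNReal.ofReal_le_ofReal_iff ?_).1 h3
  refine intervalIntegral.integral_nonneg_of_ae_restrict zero_le_one ?_
  rw [← Measure.restrict_congr_set (Ioc_ae_eq_Icc (μ := volume))]
  filter_upwards [ae_restrict_mem measurableSet_Ioc] with r hr
  exact (hsb r).nonneg fun n => hb0 n r hr

theorem hasDerivAt_polarPoint_radial (r θ : ℝ) :
    HasDerivAt (fun r => polarPoint r θ) (Complex.exp (θ * Complex.I)) r := by
  unfold polarPoint
  simpa using ((hasDerivAt_id r).ofReal_comp).mul_const (Complex.exp (θ * Complex.I))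

theorem hasDerivAt_polarPoint_angular (r θ : ℝ) :
    HasDerivAt (fun θ => polarPoint r θ) (r • (Complex.I * Complex.exp (θ * Complex.I))) θ := by
  unfold polarPoint
  refine ((((hasDerivAt_id θ).ofReal_comp).mul_const Complex.I).cexp.const_mul (r : ℂ)).congr_deriv ?_
  simp only [id, Complex.ofReal_one, one_mul, Complex.real_smul]
  ring

/-- The derivative of a function on the plane in the radial direction. -/
def radialDeriv (u : ℂ → ℂ) (r θ : ℝ) : ℂ :=
  fderiv ℝ u (polarPoint r θ) (Complex.exp (θ * Complex.I))

/-- The derivative of a function on the plane in the direction of increasing angle. -/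
def angularDeriv (u : ℂ → ℂ) (r θ : ℝ) : ℂ :=
  fderiv ℝ u (polarPoint r θ) (Complex.I * Complex.exp (θ * Complex.I))

theorem continuous_radialDeriv {u : ℂ → ℂ} (hu : ContDiff ℝ 1 u) :
    Continuous fun p : ℝ × ℝ => radialDeriv u p.1 p.2 :=
  ((hu.continuous_fderiv one_ne_zero).comp continuous_polarPoint).clm_apply (by fun_prop)

theorem continuous_angularDeriv {u : ℂ → ℂ} (hu : ContDiff ℝ 1 u) :
    Continuous fun p : ℝ × ℝ => angularDeriv u p.1 p.2 :=
  ((hu.continuous_fderiv one_ne_zero).comp continuous_polarPoint).clm_apply (by fun_prop)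

theorem fderiv_apply_eq (u : ℂ → ℂ) (z w : ℂ) :
    fderiv ℝ u z w = w.re * partialX u z + w.im * partialY u z := by
  have : w = w.re • (1 : ℂ) + w.im • Complex.I := by simp
  conv_lhs => rw [this]
  rw [map_add, map_smul, map_smul, Complex.real_smul, Complex.real_smul, partialX, partialY]

theorem norm_sq_radialDeriv_add (u : ℂ → ℂ) (r θ : ℝ) :
    ‖radialDeriv u r θ‖ ^ 2 + ‖angularDeriv u r θ‖ ^ 2 =
      ‖partialX u (polarPoint r θ)‖ ^ 2 + ‖partialY u (polarPoint r θ)‖ ^ 2 := by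
  rw [radialDeriv, angularDeriv, fderiv_apply_eq, fderiv_apply_eq]
  generalize partialX u (polarPoint r θ) = a
  generalize partialY u (polarPoint r θ) = b
  simp only [Complex.exp_ofReal_mul_I_re, Complex.exp_ofReal_mul_I_im, Complex.mul_re,
    Complex.mul_im, Complex.I_re, Complex.I_im, zero_mul, one_mul, zero_sub, zero_add,
    Complex.sq_norm, Complex.normSq_apply, Complex.add_re, Complex.add_im, Complex.ofReal_re,
    Complex.ofReal_im, sub_zero, add_zero]
  linear_combination (a.re ^ 2 + a.im ^ 2 + b.re ^ 2 + b.im ^ 2) * Real.sin_sq_add_cos_sq θ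

theorem hasDerivAt_angularMode {u : ℂ → ℂ} (hu : ContDiff ℝ 1 u) (hs : HasCompactSupport u)
    (n : ℤ) (r : ℝ) : HasDerivAt (fun r => angularMode n fun θ => u (polarPoint r θ))
      (angularMode n (radialDeriv u r)) r := by
  obtain ⟨C, hC⟩ := (hu.continuous_fderiv one_ne_zero).bounded_above_of_compact_support (hs.fderiv ℝ)
  have hc1 : ∀ t : ℝ, Continuous fun θ : ℝ => Complex.exp (-(n * θ) * Complex.I) * u (polarPoint t θ) :=
    fun t => Continuous.mul (by fun_prop) (hu.continuous.comp
      (continuous_polarPoint.comp (by fun_prop : Continuous fun θ : ℝ => (t, θ))))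
  have hc2 : ∀ t : ℝ, Continuous fun θ : ℝ =>
      Complex.exp (-(n * θ) * Complex.I) * radialDeriv u t θ :=
    fun t => Continuous.mul (by fun_prop) ((continuous_radialDeriv hu).comp
      (by fun_prop : Continuous fun θ : ℝ => (t, θ)))
  unfold angularMode
  refine HasDerivAt.const_mul _ ?_
  refine (intervalIntegral.hasDerivAt_integral_of_dominated_loc_of_deriv_le (𝕜 := ℝ)
    (s := univ) (bound := fun _ => C) univ_mem
    (F' := fun t θ => Complex.exp (-(n * θ) * Complex.I) * radialDeriv u t θ)
    (Eventually.of_forall fun t => (hc1 t).aestronglyMeasurable)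
    ((hc1 r).intervalIntegrable _ _) (hc2 r).aestronglyMeasurable ?_
    intervalIntegrable_const ?_).2
  · refine Eventually.of_forall fun θ _ t _ => ?_
    have e : (-(n * θ) * Complex.I : ℂ) = ((-(n * θ) : ℝ) : ℂ) * Complex.I := by push_cast; ring
    rw [norm_mul, e, Complex.norm_exp_ofReal_mul_I, one_mul]
    refine (ContinuousLinearMap.le_opNorm _ _).trans ?_
    rw [Complex.norm_exp_ofReal_mul_I, mul_one]
    exact hC _
  · refine Eventually.of_forall fun θ _ t _ => ?_
    refine HasDerivAt.const_mul _ ?_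
    exact ((hu.differentiable one_ne_zero) (polarPoint t θ)).hasFDerivAt.comp_hasDerivAt t
      (hasDerivAt_polarPoint_radial t θ)

/-- Integration by parts over a full period. The angular derivative is taken along a unit vector,
whence the factor `r`. -/
theorem mul_angularMode_angularDeriv {u : ℂ → ℂ} (hu : ContDiff ℝ 1 u) (n : ℤ) (r : ℝ) :
    r * angularMode n (angularDeriv u r) =
      n * Complex.I * angularMode n fun θ => u (polarPoint r θ) := by
  have hc1 : Continuous fun θ : ℝ => Complex.exp (-(n * θ) * Complex.I) * u (polarPoint r θ) :=
    Continuous.mul (by fun_prop) (hu.continuous.comp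
      (continuous_polarPoint.comp (by fun_prop : Continuous fun θ : ℝ => (r, θ))))
  have hc2 : Continuous fun θ : ℝ => Complex.exp (-(n * θ) * Complex.I) * angularDeriv u r θ :=
    Continuous.mul (by fun_prop) ((continuous_angularDeriv hu).comp
      (by fun_prop : Continuous fun θ : ℝ => (r, θ)))
  have hd : ∀ θ : ℝ, HasDerivAt
      (fun θ : ℝ => Complex.exp (-(n * θ) * Complex.I) * u (polarPoint r θ))
      (r * (Complex.exp (-(n * θ) * Complex.I) * angularDeriv u r θ) -
        n * Complex.I * (Complex.exp (-(n * θ) * Complex.I) * u (polarPoint r θ))) θ := by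
    intro θ
    have h1 := (((((hasDerivAt_id θ).ofReal_comp).const_mul (n : ℂ)).neg).mul_const
      Complex.I).cexp
    have h2 := ((hu.differentiable one_ne_zero) (polarPoint r θ)).hasFDerivAt.comp_hasDerivAt θ
      (hasDerivAt_polarPoint_angular r θ)
    refine (h1.mul h2).congr_deriv ?_
    rw [map_smul, Complex.real_smul]
    simp only [angularDeriv, id, Complex.ofReal_one, Function.comp_apply, Pi.neg_apply]
    ring
  have key := intervalIntegral.integral_eq_sub_of_hasDerivAt (a := -Real.pi) (b := Real.pi)
    (fun θ _ => hd θ) (Continuous.intervalIntegrable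
      ((continuous_const.mul hc2).sub (continuous_const.mul hc1)) _ _)
  have hper : Complex.exp (-(n * (Real.pi : ℝ)) * Complex.I) =
      Complex.exp (-(n * (-Real.pi : ℝ)) * Complex.I) := by
    rw [Complex.exp_eq_exp_iff_exists_int]
    exact ⟨-n, by push_cast; ring⟩
  have hper' : polarPoint r Real.pi = polarPoint r (-Real.pi) := by
    rw [polarPoint, polarPoint]
    congr 1
    rw [Complex.exp_eq_exp_iff_exists_int]
    exact ⟨1, by push_cast; ring⟩
  have i1 : IntervalIntegrable (fun θ : ℝ => (r : ℂ) * (Complex.exp (-(n * θ) * Complex.I) *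
      angularDeriv u r θ)) volume (-Real.pi) Real.pi :=
    (continuous_const.mul hc2).intervalIntegrable _ _
  have i2 : IntervalIntegrable (fun θ : ℝ => n * Complex.I * (Complex.exp (-(n * θ) * Complex.I) *
      u (polarPoint r θ))) volume (-Real.pi) Real.pi :=
    (continuous_const.mul hc1).intervalIntegrable _ _
  rw [hper, hper', sub_self, intervalIntegral.integral_sub i1 i2, intervalIntegral.integral_const_mul,
    intervalIntegral.integral_const_mul, sub_eq_zero] at key
  rw [angularMode, angularMode, mul_left_comm, key]
  ring

theorem exists_radius_of_compactSupport {u : ℂ → ℂ} (hs : HasCompactSupport u)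
    (hu : tsupport u ⊆ (unitDisk : Set ℂ)) : ∃ ρ < 1, ∀ z, ρ < ‖z‖ → u z = 0 := by
  rcases (tsupport u).eq_empty_or_nonempty with he | hne
  · exact ⟨0, one_pos, fun z _ => image_eq_zero_of_notMem_tsupport (by simp [he])⟩
  · obtain ⟨w, hw, hmax⟩ := IsCompact.exists_isMaxOn hs hne continuous_norm.continuousOn
    refine ⟨‖w‖, by simpa [unitDisk] using hu hw, fun z hz => ?_⟩
    exact image_eq_zero_of_notMem_tsupport fun hz' => absurd (hmax hz') (not_le.2 hz)

/-- The basic lower bound for the Dirichlet form on test functions whose angular modes vanish at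
the zeros of the Bessel functions. -/
theorem dirichlet_form_ge {lam : ℝ} (hlam : 0 < lam) {u : ℂ → ℂ} (hu : ContDiff ℝ 1 u)
    (hs : HasCompactSupport u) (hsub : tsupport u ⊆ (unitDisk : Set ℂ))
    (hzero : ∀ p ∈ besselZeroSet lam, angularMode p.1 (fun θ => u (polarPoint (p.2 / lam) θ)) = 0) :
    lam ^ 2 * ∫ z in (unitDisk : Set ℂ), ‖u z‖ ^ 2 ≤
      ∫ z in (unitDisk : Set ℂ), (‖partialX u z‖ ^ 2 + ‖partialY u z‖ ^ 2) := by
  have huc := hu.continuous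
  have hfd := hu.continuous_fderiv one_ne_zero
  have hX : Continuous (partialX u) := hfd.clm_apply continuous_const
  have hY : Continuous (partialY u) := hfd.clm_apply continuous_const
  have hpair : ∀ r : ℝ, Continuous fun θ : ℝ => (r, θ) := fun r => by fun_prop
  have hup : Continuous fun p : ℝ × ℝ => u (polarPoint p.1 p.2) := huc.comp continuous_polarPoint
  have hR := continuous_radialDeriv hu
  have hA := continuous_angularDeriv hu
  obtain ⟨ρ, hρ, hρu⟩ := exists_radius_of_compactSupport hs hsub
  set f : ℤ → ℝ → ℂ := fun n r => angularMode n fun θ => u (polarPoint r θ)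
  set f' : ℤ → ℝ → ℂ := fun n r => angularMode n (radialDeriv u r)
  set h : ℤ → ℝ → ℂ := fun n r => angularMode n (angularDeriv u r)
  have hfc : ∀ n, Continuous (f n) := fun n =>
    continuous_angularMode n (F := fun r θ => u (polarPoint r θ)) hup
  have hfc' : ∀ n, Continuous (f' n) := fun n => continuous_angularMode n hR
  have hhc : ∀ n, Continuous (h n) := fun n => continuous_angularMode n hA
  have hrad : ∀ n : ℤ, ∫ r in (0 : ℝ)..1, r * (lam ^ 2 * ‖f n r‖ ^ 2) ≤
      ∫ r in (0 : ℝ)..1, r * (‖f' n r‖ ^ 2 + ‖h n r‖ ^ 2) := by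
    intro n
    refine radial_bessel_inequality n.natAbs hlam (hasDerivAt_angularMode hu hs n) (hfc' n) (hhc n)
      (fun r hr => ?_) ?_ (fun r hr hJ => ?_)
    · have := congrArg norm (mul_angularMode_angularDeriv hu n r)
      rw [norm_mul, norm_mul, norm_mul, Complex.norm_I, mul_one, Complex.norm_real,
        Real.norm_of_nonneg hr.le, Complex.norm_intCast] at this
      rw [Nat.cast_natAbs, Int.cast_abs]
      exact this
    · filter_upwards [Ioi_mem_nhds (max_lt hρ one_pos)] with r hr
      have hr1 : ρ < r := (le_max_left _ _).trans_lt hr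
      have hr0 : 0 < r := (le_max_right _ _).trans_lt hr
      have : ∀ θ, u (polarPoint r θ) = 0 := fun θ => hρu _ (by rwa [norm_polarPoint, abs_of_pos hr0])
      simp [angularMode, this, f]
    · have := hzero (n, lam * r) ⟨mul_pos hlam hr.1, by nlinarith [hr.2], hJ⟩
      simp only [mul_div_cancel_left₀ _ hlam.ne'] at this
      exact this
  have h2π : (0 : ℝ) < (2 * Real.pi)⁻¹ := by positivity
  have main := integral_le_of_hasSum
    (a := fun n r => r * (lam ^ 2 * ‖f n r‖ ^ 2))
    (b := fun n r => r * (‖f' n r‖ ^ 2 + ‖h n r‖ ^ 2))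
    (A := fun r => r * (lam ^ 2 * ((2 * Real.pi)⁻¹ *
      ∫ θ in -Real.pi..Real.pi, ‖u (polarPoint r θ)‖ ^ 2)))
    (B := fun r => r * ((2 * Real.pi)⁻¹ * (∫ θ in -Real.pi..Real.pi, ‖radialDeriv u r θ‖ ^ 2) +
      (2 * Real.pi)⁻¹ * ∫ θ in -Real.pi..Real.pi, ‖angularDeriv u r θ‖ ^ 2))
    (fun n => by have := hfc n; fun_prop) (fun n => by have := hfc' n; have := hhc n; fun_prop)
    (by
      have : Continuous fun r : ℝ => ∫ θ in -Real.pi..Real.pi, ‖u (polarPoint r θ)‖ ^ 2 :=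
        intervalIntegral.continuous_parametric_intervalIntegral_of_continuous' (hup.norm.pow 2) _ _
      fun_prop)
    (by
      have h1 : Continuous fun r : ℝ => ∫ θ in -Real.pi..Real.pi, ‖radialDeriv u r θ‖ ^ 2 :=
        intervalIntegral.continuous_parametric_intervalIntegral_of_continuous' (hR.norm.pow 2) _ _
      have h2 : Continuous fun r : ℝ => ∫ θ in -Real.pi..Real.pi, ‖angularDeriv u r θ‖ ^ 2 :=
        intervalIntegral.continuous_parametric_intervalIntegral_of_continuous' (hA.norm.pow 2) _ _
      fun_prop)
    (fun n r hr => by have := hr.1.le; positivity) (fun n r hr => by have := hr.1.le; positivity)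
    (fun r => ((hasSum_norm_sq_angularMode (hup.comp (hpair r))).mul_left _).mul_left _)
    (fun r => ((hasSum_norm_sq_angularMode (hR.comp (hpair r))).add
      (hasSum_norm_sq_angularMode (hA.comp (hpair r)))).mul_left _) hrad
  have eL : lam ^ 2 * ∫ z in (unitDisk : Set ℂ), ‖u z‖ ^ 2 = (2 * Real.pi) *
      ∫ r in (0 : ℝ)..1, r * (lam ^ 2 * ((2 * Real.pi)⁻¹ *
        ∫ θ in -Real.pi..Real.pi, ‖u (polarPoint r θ)‖ ^ 2)) := by
    rw [integral_unitDisk (g := fun z => ‖u z‖ ^ 2) (huc.norm.pow 2), ← intervalIntegral.integral_const_mul,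
      ← intervalIntegral.integral_const_mul]
    refine intervalIntegral.integral_congr fun r _ => ?_
    simp only [smul_eq_mul, intervalIntegral.integral_const_mul]
    field_simp
  have eR : ∫ z in (unitDisk : Set ℂ), (‖partialX u z‖ ^ 2 + ‖partialY u z‖ ^ 2) = (2 * Real.pi) *
      ∫ r in (0 : ℝ)..1, r * ((2 * Real.pi)⁻¹ *
        (∫ θ in -Real.pi..Real.pi, ‖radialDeriv u r θ‖ ^ 2) +
          (2 * Real.pi)⁻¹ * ∫ θ in -Real.pi..Real.pi, ‖angularDeriv u r θ‖ ^ 2) := by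
    rw [integral_unitDisk (g := fun z => ‖partialX u z‖ ^ 2 + ‖partialY u z‖ ^ 2)
      ((hX.norm.pow 2).add (hY.norm.pow 2)),
      ← intervalIntegral.integral_const_mul]
    refine intervalIntegral.integral_congr fun r _ => ?_
    have i1 : IntervalIntegrable (fun θ => ‖radialDeriv u r θ‖ ^ 2) volume (-Real.pi) Real.pi :=
      ((hR.comp (hpair r)).norm.pow 2).intervalIntegrable _ _
    have i2 : IntervalIntegrable (fun θ => ‖angularDeriv u r θ‖ ^ 2) volume (-Real.pi) Real.pi :=
      ((hA.comp (hpair r)).norm.pow 2).intervalIntegrable _ _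
    simp only [smul_eq_mul, intervalIntegral.integral_const_mul]
    simp only [← norm_sq_radialDeriv_add]
    rw [intervalIntegral.integral_add i1 i2]
    field_simp
  rw [eL, eR]
  exact mul_le_mul_of_nonneg_left main (by positivity)

/-! ### Trace functionals -/

theorem isFiniteMeasure_unitDisk : IsFiniteMeasure (volume.restrict (unitDisk : Set ℂ)) :=
  isFiniteMeasure_restrict.2 (measure_ball_lt_top (x := (0 : ℂ)) (r := 1)).ne

/-- With `c` the real and the imaginary part, these are the weights that extract a mode of the
radial derivative from the gradient. The cutoff at `ρ` keeps them bounded. -/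
theorem memLp_traceWeight {ρ : ℝ} (hρ : 0 < ρ) (n : ℤ) {c : ℂ → ℝ} (hc : Measurable c)
    (hcz : ∀ z, |c z| ≤ ‖z‖) :
    MemLp ({z : ℂ | ρ < ‖z‖}.indicator
      fun z => (c z / ‖z‖ ^ 2 : ℂ) * Complex.exp ((n * z.arg : ℝ) * Complex.I)) 2
      (volume.restrict (unitDisk : Set ℂ)) := by
  have := isFiniteMeasure_unitDisk
  have harg := Complex.measurable_arg
  have hS : MeasurableSet {z : ℂ | ρ < ‖z‖} := (isOpen_lt continuous_const continuous_norm).measurableSet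
  refine MemLp.of_bound (C := ρ⁻¹) (Measurable.aestronglyMeasurable ?_)
    (Eventually.of_forall fun z => ?_)
  · refine Measurable.indicator ?_ hS
    fun_prop
  · by_cases hz : z ∈ {z : ℂ | ρ < ‖z‖}
    · rw [indicator_of_mem hz, norm_mul, Complex.norm_exp_ofReal_mul_I, mul_one, norm_div, norm_pow,
        Complex.norm_real, Complex.norm_real, norm_norm, Real.norm_eq_abs]
      have hz : ρ < ‖z‖ := hz
      have hz0 : 0 < ‖z‖ := hρ.trans hz
      rw [div_le_iff₀ (by positivity), inv_mul_eq_div, le_div_iff₀ hρ]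
      nlinarith [hcz z, abs_nonneg (c z)]
    · rw [indicator_of_notMem hz, norm_zero]
      positivity

/-- The angular modes of a test function on a circle are restrictions of functionals that are
continuous in the `H¹` norm. -/
theorem exists_traceFunctional (n : ℤ) {ρ : ℝ} (hρ : 0 < ρ) (hρ1 : ρ < 1) :
    ∃ l : DiskL2 × DiskL2 × DiskL2 →L[ℂ] ℂ, ∀ (u : 𝓓(unitDisk, ℂ)) (p : DiskL2 × DiskL2 × DiskL2),
      p.2.1 =ᵐ[volume.restrict (unitDisk : Set ℂ)] partialX u →
      p.2.2 =ᵐ[volume.restrict (unitDisk : Set ℂ)] partialY u →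
      l p = -(2 * Real.pi * angularMode n fun θ => u (polarPoint ρ θ)) := by
  have hX := memLp_traceWeight hρ n Complex.measurable_re Complex.abs_re_le_norm
  have hY := memLp_traceWeight hρ n Complex.measurable_im Complex.abs_im_le_norm
  -- Since `u` vanishes at radius `1`, its mode at radius `ρ` is minus the integral over `[ρ, 1]` of
  -- the mode of the radial derivative. In Cartesian coordinates this pairs the gradient with an
  -- `L²` field on the annulus.
  set l : DiskL2 × DiskL2 × DiskL2 →L[ℂ] ℂ :=
    (innerSL ℂ (hX.toLp _)).comp ((ContinuousLinearMap.fst ℂ DiskL2 DiskL2).comp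
      (ContinuousLinearMap.snd ℂ DiskL2 (DiskL2 × DiskL2))) +
    (innerSL ℂ (hY.toLp _)).comp ((ContinuousLinearMap.snd ℂ DiskL2 DiskL2).comp
      (ContinuousLinearMap.snd ℂ DiskL2 (DiskL2 × DiskL2))) with hl
  refine ⟨l, fun u p hpX hpY => ?_⟩
  have hu : ContDiff ℝ 1 u := u.contDiff.of_le (by simp)
  have hS : MeasurableSet {z : ℂ | ρ < ‖z‖} := (isOpen_lt continuous_const continuous_norm).measurableSet
  set G : ℂ → ℂ := fun z => Complex.exp (-(n * z.arg) * Complex.I) / ‖z‖ ^ 2 *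
    (z.re * partialX u z + z.im * partialY u z) with hG
  have hconj : ∀ z : ℂ, (starRingEnd ℂ) (Complex.exp ((n * z.arg : ℝ) * Complex.I)) =
      Complex.exp (-(n * z.arg) * Complex.I) := by
    intro z
    rw [← Complex.exp_conj]
    congr 1
    simp
  have e1 : l p = ∫ z in (unitDisk : Set ℂ), {z : ℂ | ρ < ‖z‖}.indicator G z := by
    change inner ℂ (hX.toLp _) p.2.1 + inner ℂ (hY.toLp _) p.2.2 = _
    rw [L2.inner_def, L2.inner_def,
      ← integral_add (L2.integrable_inner _ _) (L2.integrable_inner _ _)]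
    refine integral_congr_ae ?_
    filter_upwards [hX.coeFn_toLp, hY.coeFn_toLp, hpX, hpY] with z a b c d
    rw [a, b, c, d]
    by_cases hz : z ∈ {z : ℂ | ρ < ‖z‖}
    · simp only [indicator_of_mem hz, RCLike.inner_apply, map_mul, hconj, map_div₀, map_pow,
        Complex.conj_ofReal, hG]
      ring
    · simp [indicator_of_notMem hz]
  have hset : (unitDisk : Set ℂ) ∩ {z : ℂ | ρ < ‖z‖} = {z : ℂ | ρ < ‖z‖ ∧ ‖z‖ < 1} := by
    ext z
    simp [unitDisk, and_comm]
  have hc : Continuous fun q : ℝ × ℝ =>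
      Complex.exp (-(n * q.2) * Complex.I) * radialDeriv u q.1 q.2 :=
    Continuous.mul (by fun_prop) (continuous_radialDeriv hu)
  rw [e1, setIntegral_indicator hS, hset, integral_annulus G hρ.le hρ1.le
    (K := fun r θ => Complex.exp (-(n * θ) * Complex.I) * radialDeriv u r θ) hc]
  · have e2 : ∀ r : ℝ, ∫ θ in -Real.pi..Real.pi,
        Complex.exp (-(n * θ) * Complex.I) * radialDeriv u r θ =
        2 * Real.pi * angularMode n (radialDeriv u r) := by
      intro r
      rw [angularMode, ← mul_assoc, mul_inv_cancel₀ (by simp), one_mul]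
    simp only [e2]
    rw [intervalIntegral.integral_const_mul, intervalIntegral.integral_eq_sub_of_hasDerivAt
      (fun r _ => hasDerivAt_angularMode hu u.hasCompactSupport n r)
      ((continuous_angularMode n (continuous_radialDeriv hu)).intervalIntegrable _ _)]
    obtain ⟨R, hR, hRu⟩ := exists_radius_of_compactSupport u.hasCompactSupport u.tsupport_subset
    have : ∀ θ, u (polarPoint 1 θ) = 0 := fun θ => hRu _ (by rwa [norm_polarPoint, abs_one])
    simp only [this]
    simp [angularMode]
  · intro r hr θ hθ
    have hr0 : 0 < r := hρ.trans hr.1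
    have hrc : (r : ℂ) ≠ 0 := by exact_mod_cast hr0.ne'
    simp only [hG, arg_polarPoint hr0 hθ, norm_polarPoint, abs_of_pos hr0, radialDeriv,
      fderiv_apply_eq, Complex.real_smul]
    have h1 : (polarPoint r θ).re = r * (Complex.exp (θ * Complex.I)).re := by
      simp [polarPoint, Complex.exp_ofReal_mul_I_re]
    have h2 : (polarPoint r θ).im = r * (Complex.exp (θ * Complex.I)).im := by
      simp [polarPoint, Complex.exp_ofReal_mul_I_im]
    rw [h1, h2]
    push_cast
    field_simp

/-- Correct an approximating sequence from `V` by a linear section of `l` on its range over `V`. The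
range is finite-dimensional, so the section is continuous and the corrections tend to `0`. Thus
elements of `H¹₀` satisfying the constraints are limits of test functions satisfying them exactly.
-/
theorem mem_closure_inf_ker {X ι : Type*} [NormedAddCommGroup X] [NormedSpace ℂ X] [Finite ι]
    (V : Submodule ℂ X) (l : X →L[ℂ] (ι → ℂ)) {x : X} (hx : x ∈ V.topologicalClosure)
    (hlx : l x = 0) : x ∈ (V ⊓ LinearMap.ker l.toLinearMap).topologicalClosure := by
  set g : V →ₗ[ℂ] (ι → ℂ) := l.toLinearMap.comp V.subtype
  obtain ⟨s, hs⟩ := g.rangeRestrict.exists_rightInverse_of_surjective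
    (LinearMap.range_eq_top.2 g.surjective_rangeRestrict)
  have hs' : ∀ w, l (s w : X) = w := fun w => congrArg Subtype.val (LinearMap.congr_fun hs w)
  have hsc : Continuous s := LinearMap.continuous_of_finiteDimensional s
  rw [← SetLike.mem_coe, Submodule.topologicalClosure_coe, mem_closure_iff_seq_limit] at hx ⊢
  obtain ⟨v, hv, hvx⟩ := hx
  set w : ℕ → LinearMap.range g := fun k => ⟨l (v k), ⟨⟨v k, hv k⟩, rfl⟩⟩
  have hw : Tendsto w atTop (𝓝 0) := by
    rw [tendsto_subtype_rng]
    have := (l.continuous.tendsto x).comp hvx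
    rwa [hlx] at this
  refine ⟨fun k => v k - (s (w k) : X), fun k => ⟨V.sub_mem (hv k) (s (w k)).2, ?_⟩, ?_⟩
  · change l (v k - (s (w k) : X)) = 0
    rw [map_sub, hs', sub_self]
  · have h1 : Tendsto (fun k => (s (w k) : X)) atTop (𝓝 0) := by
      have := ((continuous_subtype_val.comp hsc).tendsto 0).comp hw
      simpa [Function.comp_def] using this
    simpa using hvx.sub h1

theorem norm_sq_eq_integral (f : DiskL2) :
    ‖f‖ ^ 2 = ∫ z in (unitDisk : Set ℂ), ‖f z‖ ^ 2 := by
  have h := L2.inner_def (𝕜 := ℂ) f f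
  simp only [inner_self_eq_norm_sq_to_K] at h
  have h2 : ∫ z in (unitDisk : Set ℂ), ((‖f z‖ : ℂ)) ^ 2 =
      ((∫ z in (unitDisk : Set ℂ), ‖f z‖ ^ 2 : ℝ) : ℂ) := by
    rw [← integral_complex_ofReal]
    push_cast
    rfl
  have h3 : ((‖f‖ ^ 2 : ℝ) : ℂ) = ((∫ z in (unitDisk : Set ℂ), ‖f z‖ ^ 2 : ℝ) : ℂ) := by
    rw [← h2, Complex.ofReal_pow]
    exact h
  exact_mod_cast h3

/-- There are finitely many continuous functionals on `H¹`, indexed by zeros of Bessel functions,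
on whose common kernel the Dirichlet form is at least `λ²` times the squared `L²` norm. -/
theorem exists_functionals_dirichlet_form_ge {lam : ℝ} (hlam : 0 < lam) :
    ∃ l : DiskL2 × DiskL2 × DiskL2 →L[ℂ] (besselZeroSet lam → ℂ), ∀ p ∈ diskH10, l p = 0 →
      lam ^ 2 * ‖p.1‖ ^ 2 ≤ ‖p.2.1‖ ^ 2 + ‖p.2.2‖ ^ 2 := by
  have : Finite (besselZeroSet lam) := finite_besselZeroSet lam
  have := isFiniteMeasure_unitDisk
  have htr : ∀ i : besselZeroSet lam, ∃ l : DiskL2 × DiskL2 × DiskL2 →L[ℂ] ℂ,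
      ∀ (u : 𝓓(unitDisk, ℂ)) (p : DiskL2 × DiskL2 × DiskL2),
      p.2.1 =ᵐ[volume.restrict (unitDisk : Set ℂ)] partialX u →
      p.2.2 =ᵐ[volume.restrict (unitDisk : Set ℂ)] partialY u →
      l p = -(2 * Real.pi * angularMode i.1.1 fun θ => u (polarPoint (i.1.2 / lam) θ)) := fun i =>
    exists_traceFunctional i.1.1 (div_pos i.2.1 hlam) ((div_lt_one hlam).2 i.2.2.1)
  choose t ht using htr
  refine ⟨ContinuousLinearMap.pi t, fun p hp hlp => ?_⟩
  have hmem := mem_closure_inf_ker testGradGraph (ContinuousLinearMap.pi t) hp hlp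
  have hclosed : IsClosed {p : DiskL2 × DiskL2 × DiskL2 |
      lam ^ 2 * ‖p.1‖ ^ 2 ≤ ‖p.2.1‖ ^ 2 + ‖p.2.2‖ ^ 2} :=
    isClosed_le (by fun_prop) (by fun_prop)
  refine (closure_minimal ?_ hclosed) hmem
  rintro q ⟨⟨u, h1, h2, h3⟩, hq⟩
  have hq' : ∀ i, t i q = 0 := fun i => congrFun (show ContinuousLinearMap.pi t q = 0 from hq) i
  have hu : ContDiff ℝ 1 u := u.contDiff.of_le (by simp)
  have key := dirichlet_form_ge hlam hu u.hasCompactSupport u.tsupport_subset fun i hi => by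
    have h := ht ⟨i, hi⟩ u q h2 h3
    rw [hq', eq_comm, neg_eq_zero] at h
    have h2π : (2 * Real.pi : ℂ) ≠ 0 := by simp
    exact (mul_eq_zero.1 h).resolve_left h2π
  have e1 : ‖q.1‖ ^ 2 = ∫ z in (unitDisk : Set ℂ), ‖u z‖ ^ 2 := by
    rw [norm_sq_eq_integral]
    refine integral_congr_ae ?_
    filter_upwards [h1] with z hz
    rw [hz]
  have e2 : ‖q.2.1‖ ^ 2 + ‖q.2.2‖ ^ 2 =
      ∫ z in (unitDisk : Set ℂ), (‖partialX u z‖ ^ 2 + ‖partialY u z‖ ^ 2) := by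
    rw [norm_sq_eq_integral, norm_sq_eq_integral,
      ← integral_add (Lp.memLp q.2.1).integrable_norm_pow' (Lp.memLp q.2.2).integrable_norm_pow']
    refine integral_congr_ae ?_
    filter_upwards [h2, h3] with z a b
    rw [a, b]
  rw [← e1, ← e2] at key
  exact key

/-! ### Eigenfunctions and the dimension count -/

open scoped ComplexConjugate in
/-- The complex conjugate of a test function. -/
def conjTest (u : 𝓓(unitDisk, ℂ)) : 𝓓(unitDisk, ℂ) where
  toFun z := conj (u z)
  contDiff' := Complex.conjCLE.contDiff.comp u.contDiff
  hasCompactSupport' := u.hasCompactSupport.comp_left (map_zero _)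
  tsupport_subset' := (tsupport_comp_subset (map_zero (starRingEnd ℂ)) u).trans u.tsupport_subset

theorem conjTest_apply (u : 𝓓(unitDisk, ℂ)) (z : ℂ) : conjTest u z = starRingEnd ℂ (u z) := rfl

theorem fderiv_conjTest (u : 𝓓(unitDisk, ℂ)) (z v : ℂ) :
    fderiv ℝ (conjTest u) z v = starRingEnd ℂ (fderiv ℝ u z v) := by
  have h : HasFDerivAt (conjTest u : ℂ → ℂ)
      ((Complex.conjCLE : ℂ →L[ℝ] ℂ).comp (fderiv ℝ u z)) z :=
    (Complex.conjCLE : ℂ →L[ℝ] ℂ).hasFDerivAt.comp z (diskTest_differentiable u z).hasFDerivAt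
  rw [h.fderiv]
  rfl

/-- The weak equation is bilinear, so it is tested against conjugates to obtain inner products. Both
sides are continuous in the triple `q`, which allows passage to the closure. -/
theorem WeakPoisson.inner_eq {ux uy f : DiskL2} (h : WeakPoisson ux uy f)
    {q : DiskL2 × DiskL2 × DiskL2} (hq : q ∈ diskH10) :
    inner ℂ q.2.1 ux + inner ℂ q.2.2 uy = inner ℂ q.1 f := by
  have hclosed : IsClosed {q : DiskL2 × DiskL2 × DiskL2 |
      inner ℂ q.2.1 ux + inner ℂ q.2.2 uy = inner ℂ q.1 f} :=
    isClosed_eq (by fun_prop) (by fun_prop)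
  refine (closure_minimal ?_ hclosed) hq
  rintro p ⟨u, h1, h2, h3⟩
  change inner ℂ p.2.1 ux + inner ℂ p.2.2 uy = inner ℂ p.1 f
  have key := h (conjTest u)
  rw [L2.inner_def, L2.inner_def, L2.inner_def,
    ← integral_add (L2.integrable_inner _ _) (L2.integrable_inner _ _)]
  convert key using 1
  · refine integral_congr_ae ?_
    filter_upwards [h2, h3] with z a b
    rw [a, b, RCLike.inner_apply, RCLike.inner_apply, partialX, partialX, partialY, partialY,
      fderiv_conjTest, fderiv_conjTest]
  · refine integral_congr_ae ?_
    filter_upwards [h1] with z a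
    rw [a, RCLike.inner_apply, conjTest_apply]

theorem inner_self_eq_ofReal_norm_sq (f : DiskL2) : inner ℂ f f = ((‖f‖ ^ 2 : ℝ) : ℂ) := by
  rw [inner_self_eq_norm_sq_to_K, Complex.ofReal_pow]
  rfl

/-- The triples `(u, ∂u/∂x, ∂u/∂y)` for `u` in the eigenspace of `μ`. -/
def eigenTriples (μ : ℝ) : Submodule ℂ (DiskL2 × DiskL2 × DiskL2) where
  carrier := {p | p ∈ diskH10 ∧ WeakPoisson p.2.1 p.2.2 ((μ : ℂ) • p.1)}
  zero_mem' := ⟨diskH10.zero_mem, by simpa using WeakPoisson.zero⟩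
  add_mem' := by
    rintro p q ⟨h, h'⟩ ⟨k, k'⟩
    exact ⟨diskH10.add_mem h k, by simpa using h'.add k'⟩
  smul_mem' := by
    rintro c p ⟨h, h'⟩
    exact ⟨diskH10.smul_mem c h, by simpa [smul_comm] using h'.smul c⟩

theorem eigenTriples.inner_eq {μ : ℝ} {p q : DiskL2 × DiskL2 × DiskL2} (hp : p ∈ eigenTriples μ)
    (hq : q ∈ diskH10) :
    inner ℂ q.2.1 p.2.1 + inner ℂ q.2.2 p.2.2 = (μ : ℂ) * inner ℂ q.1 p.1 := by
  rw [hp.2.inner_eq hq, inner_smul_right]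

theorem eigenTriples.inner_eq_zero {μ ν : ℝ} (hμν : μ ≠ ν) {p q : DiskL2 × DiskL2 × DiskL2}
    (hp : p ∈ eigenTriples μ) (hq : q ∈ eigenTriples ν) : inner ℂ q.1 p.1 = 0 := by
  have h1 := eigenTriples.inner_eq hp hq.1
  have h2 := congrArg (starRingEnd ℂ) (eigenTriples.inner_eq hq hp.1)
  rw [map_add, map_mul, inner_conj_symm, inner_conj_symm, inner_conj_symm, Complex.conj_ofReal,
    h1] at h2
  have h3 : ((μ : ℂ) - ν) * inner ℂ q.1 p.1 = 0 := by rw [sub_mul, h2, sub_self]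
  refine (mul_eq_zero.1 h3).resolve_left (sub_ne_zero.2 ?_)
  exact_mod_cast hμν

/-- Testing the equation on `p` itself bounds the gradient by the function, so uniqueness of weak
derivatives is not invoked. -/
theorem eigenTriples.eq_zero {μ : ℝ} {p : DiskL2 × DiskL2 × DiskL2} (hp : p ∈ eigenTriples μ)
    (h : p.1 = 0) : p = 0 := by
  have h1 := eigenTriples.inner_eq hp hp.1
  rw [h, inner_zero_left, mul_zero, inner_self_eq_ofReal_norm_sq, inner_self_eq_ofReal_norm_sq] at h1
  have h2 : ‖p.2.1‖ ^ 2 + ‖p.2.2‖ ^ 2 = 0 := by exact_mod_cast h1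
  have h3 : ‖p.2.1‖ = 0 := by nlinarith [sq_nonneg ‖p.2.1‖, sq_nonneg ‖p.2.2‖]
  have h4 : ‖p.2.2‖ = 0 := by nlinarith [sq_nonneg ‖p.2.1‖, sq_nonneg ‖p.2.2‖]
  exact Prod.ext h (Prod.ext (norm_eq_zero.1 h3) (norm_eq_zero.1 h4))

/-- On a finite sum of eigenfunctions the Dirichlet form and the `L²` norm are diagonal. -/
theorem norm_sq_sum_eigenTriples {ι : Type*} [Fintype ι] {μ : ι → ℝ}
    (hμ : Function.Injective μ) (x : ∀ i, eigenTriples (μ i)) :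
    ‖(∑ i, (x i : DiskL2 × DiskL2 × DiskL2)).1‖ ^ 2 = ∑ i, ‖(x i).1.1‖ ^ 2 ∧
    ‖(∑ i, (x i : DiskL2 × DiskL2 × DiskL2)).2.1‖ ^ 2 +
      ‖(∑ i, (x i : DiskL2 × DiskL2 × DiskL2)).2.2‖ ^ 2 = ∑ i, μ i * ‖(x i).1.1‖ ^ 2 := by
  classical
  set U : DiskL2 × DiskL2 × DiskL2 := ∑ i, (x i : DiskL2 × DiskL2 × DiskL2) with hU
  have hUmem : U ∈ diskH10 := diskH10.sum_mem fun i _ => (x i).2.1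
  have e1 : U.1 = ∑ i, (x i).1.1 := by rw [hU, Prod.fst_sum]
  have e2 : U.2.1 = ∑ i, (x i).1.2.1 := by rw [hU, Prod.snd_sum, Prod.fst_sum]
  have e3 : U.2.2 = ∑ i, (x i).1.2.2 := by rw [hU, Prod.snd_sum, Prod.snd_sum]
  have hdiag : ∀ i, inner ℂ U.1 (x i).1.1 = ((‖(x i).1.1‖ ^ 2 : ℝ) : ℂ) := fun i => by
    rw [e1, sum_inner, Finset.sum_eq_single i, inner_self_eq_ofReal_norm_sq]
    · exact fun j _ hj => eigenTriples.inner_eq_zero (hμ.ne hj.symm) (x i).2 (x j).2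
    · simp
  constructor
  · have h : inner ℂ U.1 U.1 = ((∑ i, ‖(x i).1.1‖ ^ 2 : ℝ) : ℂ) := by
      conv_lhs => rw [e1, inner_sum, ← e1]
      rw [Complex.ofReal_sum]
      exact Finset.sum_congr rfl fun i _ => hdiag i
    rw [inner_self_eq_ofReal_norm_sq] at h
    exact_mod_cast h
  · have h : inner ℂ U.2.1 U.2.1 + inner ℂ U.2.2 U.2.2 =
        ((∑ i, μ i * ‖(x i).1.1‖ ^ 2 : ℝ) : ℂ) := by
      conv_lhs => rw [e2, inner_sum, ← e2, e3, inner_sum, ← e3]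
      rw [Complex.ofReal_sum, ← Finset.sum_add_distrib]
      refine Finset.sum_congr rfl fun i _ => ?_
      rw [eigenTriples.inner_eq (x i).2 hUmem, hdiag]
      push_cast
      rfl
    rw [inner_self_eq_ofReal_norm_sq, inner_self_eq_ofReal_norm_sq] at h
    exact_mod_cast h

theorem dirichletMultiplicity_le (μ : ℝ) [Module.Finite ℂ (eigenTriples μ)] :
    dirichletMultiplicity μ ≤ Module.finrank ℂ (eigenTriples μ) := by
  let f : eigenTriples μ →ₗ[ℂ] dirichletEigenspace μ :=
    ((LinearMap.fst ℂ DiskL2 (DiskL2 × DiskL2)).comp (eigenTriples μ).subtype).codRestrict _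
      fun p => ⟨p.1.2.1, p.1.2.2, p.2.1, p.2.2⟩
  have hf : Function.Surjective f := by
    rintro ⟨u, ux, uy, h, h'⟩
    exact ⟨⟨(u, ux, uy), h, h'⟩, rfl⟩
  have := Module.Finite.of_surjective f hf
  rw [dirichletMultiplicity, ← Module.finrank_eq_rank, Cardinal.toENat_nat]
  exact_mod_cast LinearMap.finrank_le_finrank_of_surjective hf

/-- The sum map from a product of eigenspaces to `L² × L² × L²`. -/
def eigenSum {ι : Type*} [Fintype ι] (μ : ι → ℝ) :
    (∀ i, eigenTriples (μ i)) →ₗ[ℂ] DiskL2 × DiskL2 × DiskL2 where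
  toFun x := ∑ i, (x i : DiskL2 × DiskL2 × DiskL2)
  map_add' _ _ := Finset.sum_add_distrib
  map_smul' _ _ := Finset.smul_sum.symm

/-- The min-max step: for a sum in the kernel of `l`, the form is `∑ μ i ‖x i‖²` and at least `c ∑
‖x i‖²`. As every `μ i` is strictly below `c`, all components vanish. -/
theorem injective_comp_eigenSum {ι κ : Type*} [Fintype ι] {μ : ι → ℝ}
    (hμ : Function.Injective μ) {c : ℝ} (hc : ∀ i, μ i < c)
    {l : DiskL2 × DiskL2 × DiskL2 →ₗ[ℂ] (κ → ℂ)}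
    (hl : ∀ p ∈ diskH10, l p = 0 → c * ‖p.1‖ ^ 2 ≤ ‖p.2.1‖ ^ 2 + ‖p.2.2‖ ^ 2) :
    Function.Injective (l.comp (eigenSum μ)) := by
  rw [injective_iff_map_eq_zero]
  intro x hx
  have h := hl (∑ i, (x i : DiskL2 × DiskL2 × DiskL2)) (diskH10.sum_mem fun i _ => (x i).2.1) hx
  obtain ⟨h1, h2⟩ := norm_sq_sum_eigenTriples hμ x
  rw [h1, h2, Finset.mul_sum, ← sub_nonpos, ← Finset.sum_sub_distrib] at h
  have hnn : ∀ i ∈ Finset.univ, 0 ≤ c * ‖(x i).1.1‖ ^ 2 - μ i * ‖(x i).1.1‖ ^ 2 :=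
    fun i _ => by rw [← sub_mul]; exact mul_nonneg (sub_pos.2 (hc i)).le (sq_nonneg _)
  have h0 := (Finset.sum_eq_zero_iff_of_nonneg hnn).1 (le_antisymm h (Finset.sum_nonneg hnn))
  funext i
  have h3 := h0 i (Finset.mem_univ i)
  rw [← sub_mul] at h3
  have h4 := (mul_eq_zero.1 h3).resolve_left (sub_pos.2 (hc i)).ne'
  exact Subtype.ext
    (eigenTriples.eq_zero (x i).2 (norm_eq_zero.1 ((pow_eq_zero_iff two_ne_zero).1 h4)))

/-- The injection also yields finite-dimensionality of each eigenspace, so no compactness of the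
resolvent is required. -/
theorem sum_dirichletMultiplicity_le_card {ι κ : Type*} [Fintype ι] [Fintype κ] {μ : ι → ℝ}
    (F : (∀ i, eigenTriples (μ i)) →ₗ[ℂ] (κ → ℂ)) (hF : Function.Injective F) :
    ∑ i, dirichletMultiplicity (μ i) ≤ Fintype.card κ := by
  classical
  have hfd : ∀ i, Module.Finite ℂ (eigenTriples (μ i)) := fun i =>
    Module.Finite.of_injective (F.comp (LinearMap.single ℂ (fun i => eigenTriples (μ i)) i))
      (hF.comp (Pi.single_injective (M := fun i => eigenTriples (μ i)) i))
  calc ∑ i, dirichletMultiplicity (μ i)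
      ≤ ∑ i, (Module.finrank ℂ (eigenTriples (μ i)) : ℕ∞) :=
        Finset.sum_le_sum fun i _ => dirichletMultiplicity_le _
    _ = ((Module.finrank ℂ (∀ i, eigenTriples (μ i)) : ℕ) : ℕ∞) := by
        rw [Module.finrank_pi_fintype, Nat.cast_sum]
    _ ≤ ((Module.finrank ℂ (κ → ℂ) : ℕ) : ℕ∞) :=
        Nat.cast_le.2 (LinearMap.finrank_le_finrank_of_injective hF)
    _ = Fintype.card κ := by rw [Module.finrank_fintype_fun_eq_card]

theorem sum_dirichletMultiplicity_le {r lam : ℝ} (hr : 0 ≤ r) (hlam : r < lam)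
    (s : Finset {μ : ℝ // μ ≤ r ^ 2}) :
    ∑ μ ∈ s, dirichletMultiplicity μ ≤ (besselZeroSet lam).encard := by
  have : Finite (besselZeroSet lam) := finite_besselZeroSet lam
  have : Fintype (besselZeroSet lam) := Fintype.ofFinite _
  obtain ⟨l, hl⟩ := exists_functionals_dirichlet_form_ge (hr.trans_lt hlam)
  have hμ : Function.Injective fun i : s => (i.1 : ℝ) :=
    Subtype.val_injective.comp Subtype.val_injective
  rw [← Finset.sum_coe_sort s fun μ => dirichletMultiplicity μ, ← Set.coe_fintypeCard]
  exact sum_dirichletMultiplicity_le_card _ (injective_comp_eigenSum (l := l.toLinearMap) hμ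
    (fun i => i.1.2.trans_lt (pow_lt_pow_left₀ hlam hr two_ne_zero)) hl)

end DiskCounting

theorem mainTheorem6 (r : ℝ) (hr : 0 ≤ r) : diskCounting r ≤ latticeCounting r :=
  le_latticeCounting_of_forall_gt hr fun _ hlam =>
    iSup_le fun s => (sum_dirichletMultiplicity_le hr hlam s).trans encard_besselZeroSet_le
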